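/- Let $d\ge 2$, let $\mathcal M^d$ be the space of probability measures on the nearest neighbours $\{\pm e_i\}_{i=1}^d$ of the origin of $\mathbb Z^d$, and let $P=\nu^{\mathbb Z^d}$ be an i.i.d. law on the space of environments $\Omega=(\mathcal M^d)^{\mathbb Z^d}$, where $\nu$ is a probability measure on $\mathcal M^d$. Assume that $P$-almost surely the environment $\omega$ is balanced ($\omega(z,e)=\omega(z,-e)$ for all $z\in\mathbb Z^d$ and all unit vectors $e=\pm e_i$) and genuinely $d$-dimensional (for every $e=\pm e_i$ there is $z\in\mathbb Z^d$ with $\omega(z,e)>0$). For $N\ge 1$ let $\Delta_N=\{0,\dots,N-1\}^d$, let $P_N$ be the uniform probability measure on $\Delta_N$, and for $q\ge 1$ and $f:\Delta_N\to\mathbb R$ put $\|f\|_{\Delta_N,q}=\big(|\Delta_N|^{-1}\sum_{z\in\Delta_N}|f(z)|^q\big)^{1/q}$. The reflected walk on $\Delta_N$ in the environment $\omega$ is the Markov chain on $\Delta_N$ which from $x$ attempts to jump to $x+e$ with probability $\omega(x,e)$, $e=\pm e_i$, and stays at $x$ if $x+e\notin\Delta_N$. (Equivalently, $x+e$ is folded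 back into $\Delta_N$ by applying $t\mapsto\min(t \bmod 2N,\;2N-1-(t\bmod 2N))$ to each coordinate.) Put $p=\frac{d}{d-1}$. Then: 1. For every $p'$ with $1<p'<p$ there is a constant $C$ (depending only on $d$, $\nu$ and $p'$) such that $P$-almost surely, for all $N$ large enough, every probability measure $Q_N$ on $\Delta_N$ that is stationary for the reflected walk on $\Delta_N$ satisfies $$\left\|\frac{dQ_N}{dP_N}\right\|_{\Delta_N,p'}<C.$$ 2. There is a constant $\Phi>0$ (depending only on $d$ and $\nu$) such that $P$-almost surely, for all $N$ large enough, every probability measure $Q_N$ on $\Delta_N$ that is stationary for the reflected walk on $\Delta_N$ satisfies $|\operatorname{supp}Q_N|\ge\Phi\,|\Delta_N|$. -/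

import Mathlib

open MeasureTheory

noncomputable section

namespace RWRE

/-- The `2d` unit vectors `± e_i` of `ℤ^d`, coded by a coordinate and a sign. -/
abbrev Dir (d : ℕ) : Type := Fin d × ℤˣ

/-- The unit vector `s • e_i` coded by `e = (i, s)`. -/
def Dir.vec {d : ℕ} (e : Dir d) : Fin d → ℤ := Pi.single e.1 (e.2 : ℤ)

/-- The opposite unit vector. -/
def Dir.opp {d : ℕ} (e : Dir d) : Dir d := (e.1, -e.2)

/-- The space `𝓜^d` of probability vectors on the unit vectors, with its Borel σ-algebra. -/
abbrev SiteLaw (d : ℕ) : Type := ↥(stdSimplex ℝ (Dir d))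

/-- The space `Ω = (𝓜^d)^{ℤ^d}` of environments, with the product σ-algebra. -/
abbrev Env (d : ℕ) : Type := (Fin d → ℤ) → SiteLaw d

/-- `ω(z, e)`: the probability that the walk in the environment `ω` jumps from `z` to `z + e`. -/
def jump {d : ℕ} (ω : Env d) (z : Fin d → ℤ) (e : Dir d) : ℝ := (ω z).1 e

/-- The environment is balanced. -/
def Balanced {d : ℕ} (ω : Env d) : Prop := ∀ z e, jump ω z e = jump ω z e.opp

/-- The environment is genuinely `d`-dimensional. -/
def GenuinelyDDimensional {d : ℕ} (ω : Env d) : Prop := ∀ e, ∃ z, 0 < jump ω z e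

/-- The i.i.d. law `P = ν^{ℤ^d}` of the environment. -/
def envLaw {d : ℕ} (ν : Measure (SiteLaw d)) [IsProbabilityMeasure ν] : Measure (Env d) :=
  Measure.infinitePi fun _ : Fin d → ℤ => ν

/-- The cube `Δ_N = [0, N)^d` of `ℤ^d`. -/
def cube (d N : ℕ) : Finset (Fin d → ℤ) := Fintype.piFinset fun _ => Finset.Ico 0 (N : ℤ)

/-- The folding map `ℤ^d → Δ_N`, which in each coordinate sends `x` to
`min (x mod 2N) (2N - 1 - (x mod 2N))`. -/
def fold {d : ℕ} (N : ℕ) (z : Fin d → ℤ) : Fin d → ℤ :=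
  fun i => min (z i % (2 * N)) (2 * N - 1 - z i % (2 * N))

/-- The transition probability from `x ∈ Δ_N` to `y` of the walk in `ω` reflected at the boundary
of `Δ_N`: the walk attempts to jump from `x` to `x + e` with probability `ω(x, e)`, and the result
is folded back into `Δ_N`. For `x ∈ Δ_N` folding changes `x + e` only if `x + e ∉ Δ_N`, and then
`x + e` is folded to `x`, that is, the walk stays put. -/
def reflectedKernel {d : ℕ} (ω : Env d) (N : ℕ) (x y : Fin d → ℤ) : ℝ :=
  ∑ e : Dir d, if fold N (x + e.vec) = y then jump ω x e else 0

/-- `Q` is (the mass function of) a probability measure on `Δ_N` that is stationary for the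
reflected walk in `ω`. -/
structure IsStationary {d : ℕ} (ω : Env d) (N : ℕ) (Q : (Fin d → ℤ) → ℝ) : Prop where
  nonneg : ∀ x, 0 ≤ Q x
  eq_zero_of_notMem : ∀ x, x ∉ cube d N → Q x = 0
  sum_eq_one : ∑ x ∈ cube d N, Q x = 1
  stationary : ∀ y ∈ cube d N, ∑ x ∈ cube d N, Q x * reflectedKernel ω N x y = Q y

/-- The mass function of the uniform probability measure `P_N` on `Δ_N` at the points of `Δ_N`. -/
def uniformMass (d N : ℕ) : ℝ := 1 / ((cube d N).card : ℝ)

/-- The density `dQ / dP_N`, at the points of `Δ_N`. -/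
def density {d : ℕ} (N : ℕ) (Q : (Fin d → ℤ) → ℝ) (x : Fin d → ℤ) : ℝ := Q x / uniformMass d N

/-- `‖f‖_{Δ_N, p}`: the `L^p` norm for the uniform probability measure on `Δ_N`. -/
def cubeNorm {d : ℕ} (N : ℕ) (p : ℝ) (f : (Fin d → ℤ) → ℝ) : ℝ :=
  ((1 / ((cube d N).card : ℝ)) * ∑ z ∈ cube d N, |f z| ^ p) ^ (1 / p)

end RWRE

end

noncomputable section

namespace RWRE

open ProbabilityTheory

variable {d : ℕ}

/-! ### Unit vectors -/

/-! The density bound is a duality statement for an Alexandrov–Bakelman–Pucci (ABP) estimate in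
which ellipticity is replaced by a statement about how soon the walk moves in each coordinate.

Deterministic part. Reflecting `ω` across the faces of the cube gives a walk on `ℤ^d`, still
balanced, which folds to the reflected walk. For `f ≥ 0` let `v` solve `(1 + l) v - P v = f` with `l
= 1 / N ^ 2`. Stationarity gives `∫ f dQ = l ∫ v dQ ≤ l max v`, and `max v` is bounded by
`IsBalancedKernel.maximum_principle`. As in the classical proof, the slopes of affine functions
touching a localized `v` from above fill a cube of `ℝ^d`. The set of slopes at a single point `z` is
not bounded through a lower bound on the jump probabilities, but by running the walk from `z` until
it first moves in the coordinate `i`: its `i`-width is at most a constant times `sliceGreen`,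
provided that the walk moves in the coordinate `i` before time `k` with probability at least `1/2`
(`IsBalancedKernel.slope_diff_le`).

If the cube averages of `survival` decay polynomially fast enough in time, Hölder's inequality
bounds the `L^d` norm of `sliceGreen` by the `L^q` norm of `f`, for any fixed `q > d`. The choice `f
= (dQ/dP_N)^(p' - 1)` then bounds the density in `L^p'`, where `p'` is conjugate to `q`
(`exists_cubeNorm_density_lt`).

Probabilistic part. At each newly visited site the walk avoids moving in the coordinate `i` with
annealed probability `ρ < 1`, independently of the environment seen before. Since `|X_t|^2 - t` is a
martingale, within time `n ^ 3` the walk visits `n` sites except with probability exponentially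
small in `n`. So the annealed survival probability decays faster than any polynomial
(`exists_integral_survival_le`). A variance bound, a union bound and Borel–Cantelli, with a time
horizon `k` that is a small power of `N`, make this almost sure.

The support bound follows from the density bound by Hölder's inequality on the support. -/

lemma Dir.vec_opp (e : Dir d) : e.opp.vec = -e.vec := by
  ext j
  simp only [Dir.vec, Dir.opp, Pi.neg_apply, Pi.single_apply]
  split <;> simp

lemma Dir.opp_opp (e : Dir d) : e.opp.opp = e := by simp [Dir.opp]

/-- Passing to the opposite unit vector, as an equivalence. -/
def Dir.oppEquiv (d : ℕ) : Dir d ≃ Dir d := ⟨Dir.opp, Dir.opp, Dir.opp_opp, Dir.opp_opp⟩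

lemma sum_opp (F : Dir d → ℝ) : ∑ e : Dir d, F e.opp = ∑ e, F e :=
  (Dir.oppEquiv d).sum_comp F

lemma sum_eq_zero_of_opp {F : Dir d → ℝ} (h : ∀ e, F e.opp = -F e) : ∑ e, F e = 0 := by
  have := sum_opp F
  simp only [h, Finset.sum_neg_distrib] at this
  linarith

lemma Dir.abs_vec_le (e : Dir d) (j : Fin d) : |e.vec j| ≤ 1 := by
  simp only [Dir.vec, Pi.single_apply]
  split
  · rcases Int.units_eq_one_or e.2 with h | h <;> simp [h]
  · simp

/-! ### Balanced kernels -/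

/-- The transition probabilities of a balanced nearest neighbour walk on `ℤ^d`. -/
structure IsBalancedKernel (a : (Fin d → ℤ) → Dir d → ℝ) : Prop where
  nonneg : ∀ z e, 0 ≤ a z e
  sum_eq_one : ∀ z, ∑ e, a z e = 1
  opp : ∀ z e, a z e.opp = a z e

/-- One step of the walk, applied to a function. -/
def step (a : (Fin d → ℤ) → Dir d → ℝ) (h : (Fin d → ℤ) → ℝ) (z : Fin d → ℤ) : ℝ :=
  ∑ e, a z e * h (z + e.vec)

/-- One step of the walk killed when it moves in the coordinate `i`, applied to a function. -/
def sliceStep (a : (Fin d → ℤ) → Dir d → ℝ) (i : Fin d) (h : (Fin d → ℤ) → ℝ)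
    (z : Fin d → ℤ) : ℝ :=
  ∑ e, if e.1 = i then 0 else a z e * h (z + e.vec)

/-- The probability that the walk does not move in the coordinate `i` up to time `t`. -/
def survival (a : (Fin d → ℤ) → Dir d → ℝ) (i : Fin d) (t : ℕ) : (Fin d → ℤ) → ℝ :=
  (sliceStep a i)^[t] 1

/-- The expected sum of `f` along the walk up to time `k`, killed when it moves in the
coordinate `i`. -/
def sliceGreen (a : (Fin d → ℤ) → Dir d → ℝ) (i : Fin d) (k : ℕ) (f : (Fin d → ℤ) → ℝ)
    (z : Fin d → ℤ) : ℝ :=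
  ∑ t ∈ Finset.range k, (sliceStep a i)^[t] f z

section
variable {a : (Fin d → ℤ) → Dir d → ℝ} {i : Fin d}

lemma survival_succ (t : ℕ) (z : Fin d → ℤ) :
    survival a i (t + 1) z = sliceStep a i (survival a i t) z := by
  simp only [survival, Function.iterate_succ_apply']

lemma survival_zero (z : Fin d → ℤ) : survival a i 0 z = 1 := rfl

lemma sliceStep_mono (ha : IsBalancedKernel a) {h₁ h₂ : (Fin d → ℤ) → ℝ} (z : Fin d → ℤ)
    (h : ∀ e : Dir d, h₁ (z + e.vec) ≤ h₂ (z + e.vec)) : sliceStep a i h₁ z ≤ sliceStep a i h₂ z := by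
  refine Finset.sum_le_sum fun e _ => ?_
  split
  · exact le_rfl
  · exact mul_le_mul_of_nonneg_left (h e) (ha.nonneg z e)

lemma sliceStep_const_mul (c : ℝ) (h : (Fin d → ℤ) → ℝ) (z : Fin d → ℤ) :
    sliceStep a i (fun y => c * h y) z = c * sliceStep a i h z := by
  simp only [sliceStep, Finset.mul_sum]
  refine Finset.sum_congr rfl fun e _ => ?_
  split
  · simp
  · ring

lemma sliceStep_add (h₁ h₂ : (Fin d → ℤ) → ℝ) (z : Fin d → ℤ) :
    sliceStep a i (fun y => h₁ y + h₂ y) z = sliceStep a i h₁ z + sliceStep a i h₂ z := by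
  simp only [sliceStep, ← Finset.sum_add_distrib]
  refine Finset.sum_congr rfl fun e _ => ?_
  split
  · simp
  · ring

lemma sliceStep_sum {κ : Type*} (s : Finset κ) (h : κ → (Fin d → ℤ) → ℝ) (z : Fin d → ℤ) :
    sliceStep a i (fun y => ∑ t ∈ s, h t y) z = ∑ t ∈ s, sliceStep a i (h t) z := by
  simp only [sliceStep]
  rw [Finset.sum_comm]
  refine Finset.sum_congr rfl fun e _ => ?_
  split
  · simp
  · rw [Finset.mul_sum]

lemma iterate_sliceStep_nonneg (ha : IsBalancedKernel a) {h : (Fin d → ℤ) → ℝ}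
    (hh : ∀ z, 0 ≤ h z) (t : ℕ) (z : Fin d → ℤ) : 0 ≤ (sliceStep a i)^[t] h z := by
  induction t generalizing z with
  | zero => exact hh z
  | succ t ih =>
    rw [Function.iterate_succ_apply']
    refine Finset.sum_nonneg fun e _ => ?_
    split
    · exact le_rfl
    · exact mul_nonneg (ha.nonneg z e) (ih _)

lemma survival_nonneg (ha : IsBalancedKernel a) (t : ℕ) (z : Fin d → ℤ) :
    0 ≤ survival a i t z :=
  iterate_sliceStep_nonneg ha (fun _ => zero_le_one) t z

lemma sliceGreen_nonneg (ha : IsBalancedKernel a) {f : (Fin d → ℤ) → ℝ} (hf : ∀ z, 0 ≤ f z)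
    (k : ℕ) (z : Fin d → ℤ) : 0 ≤ sliceGreen a i k f z :=
  Finset.sum_nonneg fun t _ => iterate_sliceStep_nonneg ha hf t z

lemma sliceStep_one_le (ha : IsBalancedKernel a) (z : Fin d → ℤ) : sliceStep a i 1 z ≤ 1 := by
  rw [← ha.sum_eq_one z]
  refine Finset.sum_le_sum fun e _ => ?_
  split
  · exact ha.nonneg z e
  · simp

lemma survival_le_one (ha : IsBalancedKernel a) (t : ℕ) (z : Fin d → ℤ) :
    survival a i t z ≤ 1 := by
  induction t generalizing z with
  | zero => exact le_rfl
  | succ t ih =>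
    rw [survival_succ]
    exact (sliceStep_mono ha z fun e => ih _).trans (sliceStep_one_le ha z)

lemma sliceGreen_succ (k : ℕ) (f : (Fin d → ℤ) → ℝ) (z : Fin d → ℤ) :
    sliceGreen a i (k + 1) f z = f z + sliceStep a i (sliceGreen a i k f) z := by
  have : sliceGreen a i k f = fun y => ∑ t ∈ Finset.range k, (sliceStep a i)^[t] f y := rfl
  rw [this, sliceStep_sum, sliceGreen, Finset.sum_range_succ', add_comm]
  simp only [Function.iterate_succ_apply', Function.iterate_zero, id]

/-- If `f ≤ c` at all points within distance `t` of `x`, then the value at `x` after `t` steps of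
the killed walk is at most `c` times the survival probability. -/
lemma iterate_sliceStep_le (ha : IsBalancedKernel a) {f : (Fin d → ℤ) → ℝ} {c : ℝ} (t : ℕ)
    (x : Fin d → ℤ) (hf : ∀ y, (∀ j, |y j - x j| ≤ t) → f y ≤ c) :
    (sliceStep a i)^[t] f x ≤ c * survival a i t x := by
  induction t generalizing x with
  | zero => simpa [survival] using hf x (by simp)
  | succ t ih =>
    rw [Function.iterate_succ_apply', survival_succ, ← sliceStep_const_mul]
    refine sliceStep_mono ha x fun e => ih _ fun y hy => hf y fun j => ?_
    have h1 := hy j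
    have h2 := e.abs_vec_le j
    simp only [Pi.add_apply] at h1
    rw [abs_le] at *
    push_cast
    constructor <;> linarith [h1.1, h1.2, h2.1, h2.2]

end

/-! ### Folding -/

/-- The folding map in one coordinate. -/
def fold₁ (N : ℕ) (x : ℤ) : ℤ := min (x % (2 * N)) (2 * N - 1 - x % (2 * N))

lemma fold_apply (N : ℕ) (z : Fin d → ℤ) (j : Fin d) : fold N z j = fold₁ N (z j) := rfl

section
variable {N : ℕ}

lemma fold₁_nonneg (hN : 0 < N) (x : ℤ) : 0 ≤ fold₁ N x := by
  have h1 := Int.emod_nonneg x (b := 2 * (N : ℤ)) (by positivity)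
  have h2 := Int.emod_lt_of_pos x (b := 2 * (N : ℤ)) (by positivity)
  unfold fold₁; omega

lemma fold₁_lt (hN : 0 < N) (x : ℤ) : fold₁ N x < N := by
  have h1 := Int.emod_nonneg x (b := 2 * (N : ℤ)) (by positivity)
  have h2 := Int.emod_lt_of_pos x (b := 2 * (N : ℤ)) (by positivity)
  unfold fold₁; omega

lemma fold₁_of_mem {x : ℤ} (h0 : 0 ≤ x) (h1 : x < N) : fold₁ N x = x := by
  rw [fold₁, Int.emod_eq_of_lt h0 (by omega)]; omega

lemma fold₁_add_period (x m : ℤ) : fold₁ N (x + 2 * N * m) = fold₁ N x := by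
  simp [fold₁]

lemma fold₁_reflect (hN : 0 < N) (x : ℤ) : fold₁ N (-1 - x) = fold₁ N x := by
  have h1 := Int.emod_nonneg x (b := 2 * (N : ℤ)) (by positivity)
  have h2 := Int.emod_lt_of_pos x (b := 2 * (N : ℤ)) (by positivity)
  have h3 : (-1 - x) % (2 * N) = 2 * N - 1 - x % (2 * N) := by
    rw [Int.emod_eq_iff (by positivity)]
    refine ⟨by omega, by omega, ?_⟩
    refine ⟨x / (2 * N) + 1, ?_⟩
    linear_combination -Int.emod_add_mul_ediv x (2 * N)
  rw [fold₁, fold₁, h3]; omega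

lemma exists_eq_or_eq_reflect (N : ℕ) (x : ℤ) :
    (∃ m, x = fold₁ N x + 2 * N * m) ∨ ∃ m, x = (-1 - fold₁ N x) + 2 * N * m := by
  have h := Int.emod_add_mul_ediv x (2 * N)
  rcases le_total (x % (2 * N)) (2 * N - 1 - x % (2 * N)) with h1 | h1
  · exact .inl ⟨x / (2 * N), by rw [fold₁, min_eq_left h1]; exact h.symm⟩
  · exact .inr ⟨x / (2 * N) + 1, by rw [fold₁, min_eq_right h1]; linear_combination -h⟩

/-- Folding turns translations into translations, up to a sign. -/
lemma exists_fold₁_add (hN : 0 < N) (x : ℤ) :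
    ∃ σ : ℤˣ, ∀ t, fold₁ N (x + t) = fold₁ N (fold₁ N x + σ * t) := by
  rcases exists_eq_or_eq_reflect N x with ⟨m, hm⟩ | ⟨m, hm⟩
  · refine ⟨1, fun t => ?_⟩
    rw [← fold₁_add_period (fold₁ N x + _) m]
    congr 1
    push_cast; linear_combination hm
  · refine ⟨-1, fun t => ?_⟩
    rw [← fold₁_reflect hN (fold₁ N x + _), ← fold₁_add_period (-1 - _) m]
    congr 1
    push_cast; linear_combination hm

/-- Parity: translates of `r` by multiples of `2N` lie in even blocks of length `N`, translates of
its reflection `-1 - r` in odd ones. -/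
lemma block_ne (hN : 0 < N) {r : ℤ} (h0 : 0 ≤ r) (h1 : r < N) (m n : ℤ) :
    (r + 2 * N * m) / N ≠ (-1 - r + 2 * N * n) / N := by
  have hN' : (N : ℤ) ≠ 0 := by exact_mod_cast hN.ne'
  rw [show r + 2 * N * m = r + N * (2 * m) by ring,
    show -1 - r + 2 * N * n = (N - 1 - r) + N * (2 * n - 1) by ring,
    Int.add_mul_ediv_left _ _ hN', Int.add_mul_ediv_left _ _ hN',
    Int.ediv_eq_zero_of_lt h0 h1, Int.ediv_eq_zero_of_lt (by omega) (by omega)]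
  omega

/-- A point is determined by its folding and the block it lies in. -/
lemma eq_of_fold₁_eq (hN : 0 < N) {x y : ℤ} (h : fold₁ N x = fold₁ N y)
    (hb : x / N = y / N) : x = y := by
  have hN' : (0 : ℤ) < N := by exact_mod_cast hN
  have hd : |x - y| < N := by
    have h1 := Int.emod_add_mul_ediv x N
    have h2 := Int.emod_add_mul_ediv y N
    have h3 := Int.emod_nonneg x hN'.ne'
    have h4 := Int.emod_nonneg y hN'.ne'
    have h5 := Int.emod_lt_of_pos x hN'
    have h6 := Int.emod_lt_of_pos y hN'
    rw [hb] at h1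
    rw [abs_lt]; constructor <;> linarith
  have key : ∀ w : ℤ, |2 * (N : ℤ) * w| < N → w = 0 := by
    intro w hw
    by_contra h0
    have : (1 : ℤ) ≤ |w| := Int.one_le_abs h0
    rw [abs_mul, abs_of_pos (by positivity : (0 : ℤ) < 2 * N)] at hw
    nlinarith
  rcases exists_eq_or_eq_reflect N x with ⟨m, hm⟩ | ⟨m, hm⟩ <;>
  rcases exists_eq_or_eq_reflect N y with ⟨n, hn⟩ | ⟨n, hn⟩
  · have : m - n = 0 := key _ (by rwa [show 2 * (N : ℤ) * (m - n) = x - y by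
      linear_combination -hm + hn - h])
    obtain rfl : m = n := by omega
    rw [hm, hn, h]
  · exfalso
    exact block_ne hN (fold₁_nonneg hN x) (fold₁_lt hN x) m n
      (by rw [← hm, hb, h, ← hn])
  · exfalso
    exact block_ne hN (fold₁_nonneg hN y) (fold₁_lt hN y) n m
      (by rw [← hn, ← hb, ← h, ← hm])
  · have : m - n = 0 := key _ (by rwa [show 2 * (N : ℤ) * (m - n) = x - y by
      linear_combination -hm + hn + h])
    obtain rfl : m = n := by omega
    rw [hm, hn, h]

end

variable {N : ℕ}

/-- This keeps the folded dependence region of a point of the cube inside the unfolded box around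
it, so that distant points see disjoint sets of sites. -/
lemma fold₁_dist_le (hN : 0 < N) {r : ℤ} (h0 : 0 ≤ r) (h1 : r < N) (y : ℤ) :
    |fold₁ N y - r| ≤ |y - r| := by
  have h2 := fold₁_nonneg hN y
  have h3 := fold₁_lt hN y
  have key : ∀ m : ℤ, m ≤ -1 ∨ m = 0 ∨ 1 ≤ m := fun m => by omega
  have hN' : (0 : ℤ) < N := by exact_mod_cast hN
  rcases exists_eq_or_eq_reflect N y with ⟨m, hm⟩ | ⟨m, hm⟩
  · rcases key m with h | h | h
    · have h4 : (N : ℤ) * m ≤ -N := by nlinarith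
      refine le_trans ?_ (neg_le_abs _)
      rw [abs_le]; constructor <;> linarith
    · subst h
      rw [mul_zero, add_zero] at hm
      rw [← hm]
    · have h4 : (N : ℤ) ≤ N * m := by nlinarith
      refine le_trans ?_ (le_abs_self _)
      rw [abs_le]; constructor <;> linarith
  · have h' : m ≤ 0 ∨ 1 ≤ m := by omega
    rcases h' with h | h
    · have h4 : (N : ℤ) * m ≤ 0 := by nlinarith
      refine le_trans ?_ (neg_le_abs _)
      rw [abs_le]; constructor <;> linarith
    · have h4 : (N : ℤ) ≤ N * m := by nlinarith
      refine le_trans ?_ (le_abs_self _)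
      rw [abs_le]; constructor <;> linarith

lemma mem_cube {x : Fin d → ℤ} : x ∈ cube d N ↔ ∀ j, 0 ≤ x j ∧ x j < N := by
  simp [cube, Fintype.mem_piFinset]

lemma card_cube : ((cube d N).card : ℝ) = (N : ℝ) ^ d := by
  simp [cube, Fintype.card_piFinset]

lemma fold_mem_cube (hN : 0 < N) (z : Fin d → ℤ) : fold N z ∈ cube d N :=
  mem_cube.2 fun j => ⟨fold₁_nonneg hN (z j), fold₁_lt hN (z j)⟩

lemma fold_of_mem {x : Fin d → ℤ} (hx : x ∈ cube d N) : fold N x = x :=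
  funext fun j => fold₁_of_mem (mem_cube.1 hx j).1 (mem_cube.1 hx j).2

lemma fold_fold (hN : 0 < N) (z : Fin d → ℤ) : fold N (fold N z) = fold N z :=
  fold_of_mem (fold_mem_cube hN z)

lemma exists_fold_add (hN : 0 < N) (z : Fin d → ℤ) :
    ∃ σ : Fin d → ℤˣ, ∀ e : Dir d,
      fold N (z + e.vec) = fold N (fold N z + Dir.vec (e.1, σ e.1 * e.2)) := by
  choose σ hσ using fun j => exists_fold₁_add hN (z j)
  refine ⟨σ, fun e => funext fun j => ?_⟩
  rw [fold_apply, fold_apply, Pi.add_apply, hσ j, Pi.add_apply, fold_apply]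
  congr 2
  by_cases h : j = e.1
  · subst h; simp [Dir.vec]
  · simp [Dir.vec, h]

/-- The region `[-2N, 3N)` consists of five blocks of length `N` in each coordinate, and folding is
injective on each block. -/
lemma sum_fold_le (hN : 0 < N) {A : Finset (Fin d → ℤ)}
    (hA : ∀ z ∈ A, ∀ j, -(2 * (N : ℤ)) ≤ z j ∧ z j < 3 * N) {h : (Fin d → ℤ) → ℝ}
    (hh : ∀ x, 0 ≤ h x) : ∑ z ∈ A, h (fold N z) ≤ 5 ^ d * ∑ x ∈ cube d N, h x := by
  have hN' : (0 : ℤ) < N := by exact_mod_cast hN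
  let φ : (Fin d → ℤ) → (Fin d → ℤ) × (Fin d → ℤ) := fun z => (fold N z, fun j => z j / N)
  have hφ : Function.Injective φ := fun x y hxy => by
    have h1 := congrArg Prod.fst hxy
    have h2 := congrArg Prod.snd hxy
    exact funext fun j => eq_of_fold₁_eq hN (congrFun h1 j) (congrFun h2 j)
  have h1 : ∑ z ∈ A, h (fold N z) = ∑ p ∈ A.image φ, h p.1 := by
    rw [Finset.sum_image fun x _ y _ hxy => hφ hxy]
  have h2 : A.image φ ⊆ cube d N ×ˢ Fintype.piFinset fun _ => Finset.Ico (-2 : ℤ) 3 := by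
    intro p hp
    obtain ⟨z, hz, rfl⟩ := Finset.mem_image.1 hp
    refine Finset.mem_product.2 ⟨fold_mem_cube hN z, Fintype.mem_piFinset.2 fun j => ?_⟩
    have := hA z hz j
    rw [Finset.mem_Ico]
    exact ⟨by rw [Int.le_ediv_iff_mul_le hN']; linarith, by
      rw [Int.ediv_lt_iff_lt_mul hN']; linarith⟩
  rw [h1]
  refine (Finset.sum_le_sum_of_subset_of_nonneg h2 fun p _ _ => hh _).trans ?_
  rw [Finset.sum_product]
  simp [Finset.mul_sum]

/-! ### The environment folded out to `ℤ^d` -/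

/-- The environment `ω` on `Δ_N`, extended to `ℤ^d` by reflections. -/
def foldKernel (ω : Env d) (N : ℕ) (z : Fin d → ℤ) (e : Dir d) : ℝ := jump ω (fold N z) e

lemma Balanced.isBalancedKernel {ω : Env d} (hω : Balanced ω) (N : ℕ) :
    IsBalancedKernel (foldKernel ω N) where
  nonneg _ e := (ω _).2.1 e
  sum_eq_one _ := (ω _).2.2
  opp _ e := (hω _ e).symm

lemma foldKernel_fold (hN : 0 < N) (ω : Env d) (z : Fin d → ℤ) :
    foldKernel ω N (fold N z) = foldKernel ω N z := by
  ext e; rw [foldKernel, foldKernel, fold_fold hN]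

lemma IsBalancedKernel.units_mul {a : (Fin d → ℤ) → Dir d → ℝ} (ha : IsBalancedKernel a)
    (z : Fin d → ℤ) (σ : ℤˣ) (e : Dir d) : a z (e.1, σ * e.2) = a z e := by
  rcases Int.units_eq_one_or σ with h | h
  · simp [h]
  · simpa [h, Dir.opp] using ha.opp z e

/-- Multiplying the signs of unit vectors by fixed signs, as an equivalence. -/
def signEquiv (σ : Fin d → ℤˣ) : Dir d ≃ Dir d where
  toFun e := (e.1, σ e.1 * e.2)
  invFun e := (e.1, σ e.1 * e.2)
  left_inv e := by simp [← mul_assoc]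
  right_inv e := by simp [← mul_assoc]

/-- Folding turns the step `e` into `± e`, and a balanced kernel does not see the sign. The weight
`c` depends on the coordinate only: the constant `1` gives `step`, the indicator of the coordinates
other than `i` gives `sliceStep`. -/
lemma sum_foldKernel_fold (hN : 0 < N) {ω : Env d} (hω : Balanced ω) (c : Fin d → ℝ)
    {h : (Fin d → ℤ) → ℝ} (hh : ∀ z, h (fold N z) = h z) (z : Fin d → ℤ) :
    ∑ e : Dir d, c e.1 * (foldKernel ω N (fold N z) e * h (fold N z + e.vec)) =
      ∑ e : Dir d, c e.1 * (foldKernel ω N z e * h (z + e.vec)) := by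
  obtain ⟨σ, hσ⟩ := exists_fold_add hN z
  rw [foldKernel_fold hN, ← (signEquiv σ).sum_comp]
  refine Finset.sum_congr rfl fun e _ => ?_
  rw [← hh (z + e.vec), hσ, hh]
  show c e.1 * (foldKernel ω N z (e.1, σ e.1 * e.2) * _) = _
  rw [(hω.isBalancedKernel N).units_mul]
  rfl

lemma step_fold (hN : 0 < N) {ω : Env d} (hω : Balanced ω) {h : (Fin d → ℤ) → ℝ}
    (hh : ∀ z, h (fold N z) = h z) (z : Fin d → ℤ) :
    step (foldKernel ω N) h (fold N z) = step (foldKernel ω N) h z := by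
  simpa [step] using sum_foldKernel_fold hN hω (fun _ => 1) hh z

lemma iterate_sliceStep_fold (hN : 0 < N) {ω : Env d} (hω : Balanced ω) (i : Fin d)
    {h : (Fin d → ℤ) → ℝ} (hh : ∀ z, h (fold N z) = h z) (t : ℕ) (z : Fin d → ℤ) :
    (sliceStep (foldKernel ω N) i)^[t] h (fold N z) =
      (sliceStep (foldKernel ω N) i)^[t] h z := by
  induction t generalizing z with
  | zero => exact hh z
  | succ t ih =>
    simp only [Function.iterate_succ_apply']
    simpa [sliceStep, ite_mul] using
      sum_foldKernel_fold hN hω (fun j => if j = i then 0 else 1) ih z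

lemma survival_fold (hN : 0 < N) {ω : Env d} (hω : Balanced ω) (i : Fin d) (t : ℕ)
    (z : Fin d → ℤ) :
    survival (foldKernel ω N) i t (fold N z) = survival (foldKernel ω N) i t z :=
  iterate_sliceStep_fold hN hω i (fun _ => rfl) t z

lemma sliceGreen_fold (hN : 0 < N) {ω : Env d} (hω : Balanced ω) (i : Fin d) (k : ℕ)
    {f : (Fin d → ℤ) → ℝ} (hf : ∀ z, f (fold N z) = f z) (z : Fin d → ℤ) :
    sliceGreen (foldKernel ω N) i k f (fold N z) = sliceGreen (foldKernel ω N) i k f z :=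
  Finset.sum_congr rfl fun t _ => iterate_sliceStep_fold hN hω i hf t z

/-! ### Stationary measures and the resolvent -/

lemma IsStationary.sum_step {ω : Env d} (hN : 0 < N) {Q : (Fin d → ℤ) → ℝ}
    (hQ : IsStationary ω N Q) {v : (Fin d → ℤ) → ℝ} (hv : ∀ z, v (fold N z) = v z) :
    ∑ x ∈ cube d N, Q x * step (foldKernel ω N) v x = ∑ x ∈ cube d N, Q x * v x := by
  have h1 : ∀ x ∈ cube d N, step (foldKernel ω N) v x =
      ∑ y ∈ cube d N, reflectedKernel ω N x y * v y := by
    intro x hx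
    simp only [reflectedKernel, Finset.sum_mul, ite_mul, zero_mul]
    rw [Finset.sum_comm]
    refine Finset.sum_congr rfl fun e _ => ?_
    rw [Finset.sum_ite_eq, if_pos (fold_mem_cube hN _), hv, foldKernel, fold_of_mem hx]
  calc ∑ x ∈ cube d N, Q x * step (foldKernel ω N) v x
      = ∑ x ∈ cube d N, ∑ y ∈ cube d N, Q x * reflectedKernel ω N x y * v y := by
        refine Finset.sum_congr rfl fun x hx => ?_
        rw [h1 x hx, Finset.mul_sum]
        exact Finset.sum_congr rfl fun y _ => by ring
    _ = ∑ y ∈ cube d N, Q y * v y := by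
        rw [Finset.sum_comm]
        refine Finset.sum_congr rfl fun y hy => ?_
        rw [← Finset.sum_mul, hQ.stationary y hy]

/-- The resolvent equation `(1 + l) v - P v = f` of the reflected walk. -/
lemma exists_resolvent (hN : 0 < N) {ω : Env d} (hω : Balanced ω) {l : ℝ} (hl : 0 < l)
    (f : (Fin d → ℤ) → ℝ) : ∃ v : (Fin d → ℤ) → ℝ, (∀ z, v (fold N z) = v z) ∧
      ∀ z, step (foldKernel ω N) v z = (1 + l) * v z - f (fold N z) := by
  let r : (Fin d → ℤ) → cube d N := fun z => ⟨fold N z, fold_mem_cube hN z⟩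
  have hr : ∀ x : cube d N, r x = x := fun x => Subtype.ext (fold_of_mem x.2)
  have hrf : ∀ z, r (fold N z) = r z := fun z => Subtype.ext (fold_fold hN z)
  let T : (cube d N → ℝ) →ₗ[ℝ] (cube d N → ℝ) :=
    { toFun := fun v x => (1 + l) * v x - step (foldKernel ω N) (v ∘ r) x
      map_add' := fun v w => by
        ext x
        simp only [step, Pi.add_apply, Function.comp, mul_add, Finset.sum_add_distrib]
        ring
      map_smul' := fun c v => by
        ext x
        simp only [step, Pi.smul_apply, Function.comp, smul_eq_mul, RingHom.id_apply,
          mul_left_comm _ c, ← Finset.mul_sum]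
        ring }
  -- Maximum principle: at a maximum `x` of a solution of the homogeneous equation, `(1 + l) v x = P
  -- v x ≤ v x`, so `v x ≤ 0`. Applied to `v` and `-v` it gives injectivity, hence surjectivity in
  -- finite dimension.
  have hle : ∀ v, T v = 0 → ∀ x, v x ≤ 0 := by
    intro v hv
    have : Nonempty (cube d N) := ⟨r 0⟩
    obtain ⟨x, hx⟩ := Finite.exists_max v
    have h1 : (1 + l) * v x - step (foldKernel ω N) (v ∘ r) x = 0 := congrFun hv x
    have h2 : step (foldKernel ω N) (v ∘ r) x ≤ v x := by
      have hk := hω.isBalancedKernel N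
      calc step (foldKernel ω N) (v ∘ r) x ≤ ∑ e, foldKernel ω N x e * v x :=
            Finset.sum_le_sum fun e _ => mul_le_mul_of_nonneg_left (hx _) (hk.nonneg _ _)
        _ = v x := by rw [← Finset.sum_mul, hk.sum_eq_one, one_mul]
    intro y
    refine (hx y).trans ?_
    nlinarith
  have hinj : Function.Injective T := by
    rw [← LinearMap.ker_eq_bot, LinearMap.ker_eq_bot']
    intro v hv
    ext x
    refine le_antisymm (hle v hv x) ?_
    have := hle (-v) (by rw [map_neg, hv, neg_zero]) x
    simpa using this
  obtain ⟨v, hv⟩ := LinearMap.injective_iff_surjective.1 hinj fun x => f x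
  have hvr : ∀ z, (v ∘ r) (fold N z) = (v ∘ r) z := fun z => congrArg v (hrf z)
  refine ⟨v ∘ r, hvr, fun z => ?_⟩
  have h1 : (1 + l) * v (r z) - step (foldKernel ω N) (v ∘ r) (r z) = f (r z) := congrFun hv (r z)
  rw [← step_fold hN hω hvr]
  simp only [Function.comp]
  linarith [h1]

/-! ### ### The maximum principle -/

section
variable {a : (Fin d → ℤ) → Dir d → ℝ}

lemma IsBalancedKernel.sum_mul_odd (ha : IsBalancedKernel a) (z : Fin d → ℤ) {R : Dir d → ℝ}
    (hR : ∀ e, R e.opp = -R e) : ∑ e, a z e * R e = 0 :=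
  sum_eq_zero_of_opp fun e => by rw [ha.opp, hR]; ring

lemma IsBalancedKernel.step_sq (ha : IsBalancedKernel a) (x z : Fin d → ℤ) :
    step a (fun y => ∑ j, ((y j : ℝ) - x j) ^ 2) z = ∑ j, ((z j : ℝ) - x j) ^ 2 + 1 := by
  have h1 : ∀ e : Dir d, ∑ j, (((z + e.vec) j : ℤ) - (x j : ℝ)) ^ 2 =
      (∑ j, ((z j : ℝ) - x j) ^ 2 + 1) + ∑ j, 2 * ((z j : ℝ) - x j) * e.vec j := by
    intro e
    have h2 : ∑ j, (e.vec j : ℝ) ^ 2 = 1 := by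
      rw [Finset.sum_eq_single e.1]
      · rcases Int.units_eq_one_or e.2 with h | h <;> simp [Dir.vec, h]
      · intro j _ hj; simp [Dir.vec, hj]
      · simp
    rw [← h2, ← Finset.sum_add_distrib, ← Finset.sum_add_distrib]
    refine Finset.sum_congr rfl fun j _ => ?_
    push_cast [Pi.add_apply]
    ring
  simp only [step, h1, mul_add, Finset.sum_add_distrib, ← Finset.sum_mul, ha.sum_eq_one]
  rw [ha.sum_mul_odd z fun e => ?_]
  · ring
  · simp [Dir.vec_opp, Finset.sum_neg_distrib]

/-- Two affine functions that touch `u` from above at `z`, and lie above `u` within distance `k`,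
have slopes whose `i`-th coordinates are close. -/
lemma IsBalancedKernel.slope_diff_le (ha : IsBalancedKernel a) {f u : (Fin d → ℤ) → ℝ}
    (hu : ∀ z, u z ≤ f z + step a u z) (i : Fin d) (k : ℕ) (z : Fin d → ℤ) {p p' : Fin d → ℝ}
    (hp : ∀ y : Fin d → ℤ, (∀ j, |y j - z j| ≤ k) → u y ≤ u z + ∑ j, p j * (y j - z j))
    (hp' : ∀ y : Fin d → ℤ, (∀ j, |y j - z j| ≤ k) → u y ≤ u z + ∑ j, p' j * (y j - z j)) :
    (p' i - p i) * (1 - survival a i k z) ≤ 2 * sliceGreen a i k f z := by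
  set l : (Fin d → ℤ) → ℝ := fun y => u z + ∑ j, p j * (y j - z j) with hl
  set l' : (Fin d → ℤ) → ℝ := fun y => u z + ∑ j, p' j * (y j - z j) with hl'
  have hadd : ∀ (r : Fin d → ℝ) (y : Fin d → ℤ) (e : Dir d),
      ∑ j, r j * (((y + e.vec) j : ℤ) - (z j : ℝ)) =
        ∑ j, r j * ((y j : ℝ) - z j) + r e.1 * ((e.2 : ℤ) : ℝ) := by
    intro r y e
    have : ∑ j, r j * ((e.vec j : ℤ) : ℝ) = r e.1 * ((e.2 : ℤ) : ℝ) := by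
      rw [Finset.sum_eq_single e.1]
      · simp [Dir.vec]
      · intro j _ hj; simp [Dir.vec, hj]
      · simp
    rw [← this, ← Finset.sum_add_distrib]
    refine Finset.sum_congr rfl fun j _ => ?_
    push_cast [Pi.add_apply]
    ring
  have hladd : ∀ y e, l (y + Dir.vec e) = l y + p e.1 * ((e.2 : ℤ) : ℝ) := fun y e => by
    simp only [hl, hadd]; ring
  have hladd' : ∀ y e, l' (y + Dir.vec e) = l' y + p' e.1 * ((e.2 : ℤ) : ℝ) := fun y e => by
    simp only [hl', hadd]; ring
  set δ := (p' i - p i) / 2 with hδ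
  -- As long as the walk has not moved in the coordinate `i`, `u` is compared with the average of
  -- `l` and `l'`, which is harmonic by balance. At the first move in the coordinate `i`, `l` is
  -- used after a step `+e_i` and `l'` after `-e_i`. The two are equally likely, and this choice
  -- gains `δ` on average.
  have key : ∀ (t : ℕ) (y : Fin d → ℤ),
      (∀ w : Fin d → ℤ, (∀ j, |w j - y j| ≤ t) → u w ≤ l w ∧ u w ≤ l' w) →
      u y ≤ sliceGreen a i t f y + (l y + l' y) / 2 - δ * (1 - survival a i t y) := by
    intro t
    induction t with
    | zero =>
      intro y hy
      have := hy y (by simp)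
      simp only [sliceGreen, Finset.range_zero, Finset.sum_empty, survival_zero]
      linarith [this.1, this.2]
    | succ t ih =>
      intro y hy
      have hnear : ∀ (e : Dir d) (w : Fin d → ℤ), (∀ j, |w j - (y + e.vec) j| ≤ t) →
          ∀ j, |w j - y j| ≤ (t + 1 : ℕ) := by
        intro e w hw j
        have h1 := hw j
        have h2 := e.abs_vec_le j
        rw [Pi.add_apply] at h1
        rw [abs_le] at *
        push_cast
        constructor <;> linarith [h1.1, h1.2, h2.1, h2.2]
      -- The part of the upper bound that is odd in `e`; it averages to zero. For `e.1 = i` the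
      -- bound below is exactly `l y + p i` or `l' y - p' i`, according to the sign.
      let R : Dir d → ℝ := fun e =>
        ((e.2 : ℤ) : ℝ) * ((p e.1 + p' e.1) / 2 + if e.1 = i then (l y - l' y) / 2 else 0)
      have hR : ∀ e, R e.opp = -R e := fun e => by simp [R, Dir.opp]
      have hterm : ∀ e : Dir d, u (y + e.vec) ≤
          (if e.1 = i then 0 else sliceGreen a i t f (y + e.vec) +
            δ * survival a i t (y + e.vec)) + ((l y + l' y) / 2 - δ) + R e := by
        intro e
        by_cases he : e.1 = i
        · have h1 := hy (y + e.vec) (hnear e _ (by simp))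
          rw [hladd, hladd'] at h1
          simp only [R, he, if_true]
          rw [he] at h1
          rcases Int.units_eq_one_or e.2 with h | h
          · rw [h] at h1 ⊢
            simp only [Units.val_one, Int.cast_one, mul_one, one_mul] at h1 ⊢
            linarith [h1.1]
          · rw [h] at h1 ⊢
            simp only [Units.val_neg, Units.val_one, Int.cast_neg, Int.cast_one] at h1 ⊢
            linarith [h1.2]
        · have h1 := ih (y + e.vec) fun w hw => hy w (hnear e w hw)
          rw [hladd, hladd'] at h1
          simp only [R, if_neg he]
          linarith
      calc u y ≤ f y + step a u y := hu y
        _ ≤ f y + ∑ e, a y e * ((if e.1 = i then 0 else sliceGreen a i t f (y + e.vec) +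
            δ * survival a i t (y + e.vec)) + ((l y + l' y) / 2 - δ) + R e) := by
          gcongr with e
          exact Finset.sum_le_sum fun e _ => mul_le_mul_of_nonneg_left (hterm e) (ha.nonneg _ _)
        _ = f y + (∑ e, a y e * (if e.1 = i then 0 else sliceGreen a i t f (y + e.vec) +
            δ * survival a i t (y + e.vec))) + ((l y + l' y) / 2 - δ) := by
          simp only [mul_add (a y _) (_ + _) (R _), mul_add (a y _) (ite _ _ _) _,
            Finset.sum_add_distrib, ha.sum_mul_odd y hR, ← Finset.sum_mul, ha.sum_eq_one]
          ring
        _ = f y + sliceStep a i (fun w => sliceGreen a i t f w + δ * survival a i t w) y +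
            ((l y + l' y) / 2 - δ) := by simp only [sliceStep, mul_ite, mul_zero]
        _ = _ := by
          rw [sliceStep_add, sliceStep_const_mul, sliceGreen_succ, survival_succ]
          ring
  have h1 := key k z fun w hw => ⟨hp w hw, hp' w hw⟩
  have h2 : l z = u z := by simp [hl]
  have h3 : l' z = u z := by simp [hl']
  rw [h2, h3, hδ] at h1
  linarith

/-- An Alexandrov–Bakelman–Pucci type maximum principle for walks that need not be elliptic. -/
lemma IsBalancedKernel.maximum_principle (ha : IsBalancedKernel a) (hd : 0 < d) (hN : 0 < N)
    {k : ℕ} (hk : k ≤ N) {f u : (Fin d → ℤ) → ℝ} (hf : ∀ z, 0 ≤ f z)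
    (hu : ∀ z, u z ≤ f z + step a u z) {x₀ : Fin d → ℤ}
    (hsupp : ∀ z, (¬ ∀ j, |z j - x₀ j| ≤ 2 * N) → u z = 0) (hx₀ : 0 < u x₀)
    (hq : ∀ i z, survival a i k z ≤ 1 / 2) :
    (u x₀ / (2 * d * N)) ^ d ≤
      ∑ z ∈ Fintype.piFinset fun j => Finset.Icc (x₀ j - 2 * N) (x₀ j + 2 * N),
        ∏ i, 4 * sliceGreen a i k f z := by
  have hN' : (0 : ℝ) < N := by exact_mod_cast hN
  have hd' : (0 : ℝ) < d := by exact_mod_cast hd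
  set B := Fintype.piFinset fun j => Finset.Icc (x₀ j - 2 * N) (x₀ j + 2 * N) with hB
  set D := Fintype.piFinset fun j => Finset.Icc (x₀ j - 3 * N) (x₀ j + 3 * N) with hD
  have hmemB : ∀ z, z ∈ B ↔ ∀ j, |z j - x₀ j| ≤ 2 * N := fun z => by
    simp only [hB, Fintype.mem_piFinset, Finset.mem_Icc, abs_le]
    exact forall_congr' fun j => by constructor <;> rintro ⟨h1, h2⟩ <;> constructor <;> linarith
  have hmemD : ∀ z, z ∈ D ↔ ∀ j, |z j - x₀ j| ≤ 3 * N := fun z => by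
    simp only [hD, Fintype.mem_piFinset, Finset.mem_Icc, abs_le]
    exact forall_congr' fun j => by constructor <;> rintro ⟨h1, h2⟩ <;> constructor <;> linarith
  -- A slope with entries at most `η` varies by at most `3dNη = 3/4 * u x₀` between `x₀` and a point
  -- of `D`. So the maximum over `D` of `u` minus this linear function is not attained where `u =
  -- 0`.
  set η := u x₀ / (4 * d * N) with hη
  have hη0 : 0 < η := by positivity
  let I : (Fin d → ℤ) → Set (Fin d → ℝ) := fun z =>
    {p | ∀ y : Fin d → ℤ, (∀ j, |y j - z j| ≤ k) → u y ≤ u z + ∑ j, p j * (y j - z j)}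
  have hcover : Set.Icc (fun _ => -η) (fun _ => η) ⊆ ⋃ z ∈ B, I z := by
    intro p hp
    have hpabs : ∀ j, |p j| ≤ η := fun j => abs_le.2 ⟨hp.1 j, hp.2 j⟩
    have hx₀D : x₀ ∈ D := (hmemD x₀).2 fun j => by simp
    obtain ⟨z, hzD, hz⟩ := Finset.exists_max_image D
      (fun x => u x - ∑ j, p j * ((x j : ℝ) - x₀ j)) ⟨x₀, hx₀D⟩
    have hzx := hz x₀ hx₀D
    simp only [sub_self, mul_zero, Finset.sum_const_zero, sub_zero] at hzx
    have hzB : z ∈ B := by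
      by_contra h
      rw [hmemB] at h
      rw [hsupp z h] at hzx
      have h1 : -∑ j, p j * ((z j : ℝ) - x₀ j) ≤ ∑ _j : Fin d, η * (3 * N) := by
        rw [← Finset.sum_neg_distrib]
        refine Finset.sum_le_sum fun j _ => ?_
        refine (neg_le_abs _).trans ?_
        rw [abs_mul]
        have h2 : |(z j : ℝ) - x₀ j| ≤ 3 * N := by exact_mod_cast (hmemD z).1 hzD j
        gcongr
        exact hpabs j
      have h3 : ∑ _j : Fin d, η * (3 * N) = 3 / 4 * u x₀ := by
        rw [Finset.sum_const, Finset.card_univ, Fintype.card_fin, nsmul_eq_mul, hη]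
        field_simp
      linarith
    simp only [Set.mem_iUnion]
    refine ⟨z, hzB, fun y hy => ?_⟩
    -- The margin `N` between `B` and `D` accommodates the contact radius `k ≤ N`.
    have hyD : y ∈ D := by
      rw [hmemD]
      intro j
      have h1 := hy j
      have h2 := (hmemB z).1 hzB j
      have h3 : (k : ℤ) ≤ N := by exact_mod_cast hk
      rw [abs_le] at *
      constructor <;> linarith [h1.1, h1.2, h2.1, h2.2]
    have h1 := hz y hyD
    have h2 : ∑ j, p j * ((y j : ℝ) - z j) =
        ∑ j, p j * ((y j : ℝ) - x₀ j) - ∑ j, p j * ((z j : ℝ) - x₀ j) := by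
      rw [← Finset.sum_sub_distrib]
      exact Finset.sum_congr rfl fun j _ => by ring
    linarith
  -- The volume is at most the product of the coordinate widths. Survival at most `1/2` turns the
  -- slope estimate into width at most `4 * sliceGreen`.
  have hvol : ∀ z, volume (I z) ≤ ENNReal.ofReal (∏ i, 4 * sliceGreen a i k f z) := by
    intro z
    refine (Real.volume_pi_le_prod_diam _).trans ?_
    rw [ENNReal.ofReal_prod_of_nonneg fun i _ =>
      mul_nonneg (by norm_num) (sliceGreen_nonneg ha hf k z)]
    refine Finset.prod_le_prod' fun i _ => Metric.ediam_le ?_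
    have key : ∀ p ∈ I z, ∀ p' ∈ I z, p' i - p i ≤ 4 * sliceGreen a i k f z := by
      intro p hp p' hp'
      have h1 := ha.slope_diff_le hu i k z hp hp'
      have h2 := hq i z
      have h3 := sliceGreen_nonneg (i := i) ha hf k z
      by_contra! h4
      nlinarith
    rintro _ ⟨p, hp, rfl⟩ _ ⟨p', hp', rfl⟩
    rw [edist_dist, Real.dist_eq]
    refine ENNReal.ofReal_le_ofReal (abs_le.2 ⟨?_, ?_⟩)
    · have := key p hp p' hp'
      simp only [Function.eval]; linarith
    · exact key p' hp' p hp
  have hmain : ENNReal.ofReal ((u x₀ / (2 * d * N)) ^ d) ≤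
      ENNReal.ofReal (∑ z ∈ B, ∏ i, 4 * sliceGreen a i k f z) := by
    calc ENNReal.ofReal ((u x₀ / (2 * d * N)) ^ d)
        = volume (Set.Icc (fun _ : Fin d => -η) (fun _ => η)) := by
          rw [Real.volume_Icc_pi, Finset.prod_const, Finset.card_univ, Fintype.card_fin,
            ENNReal.ofReal_pow (by positivity)]
          congr 2
          rw [hη]; field_simp; norm_num
      _ ≤ volume (⋃ z ∈ B, I z) := measure_mono hcover
      _ ≤ ∑ z ∈ B, volume (I z) := measure_biUnion_finset_le _ _
      _ ≤ ∑ z ∈ B, ENNReal.ofReal (∏ i, 4 * sliceGreen a i k f z) :=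
          Finset.sum_le_sum fun z _ => hvol z
      _ = _ := by
          rw [ENNReal.ofReal_sum_of_nonneg]
          exact fun z _ => Finset.prod_nonneg fun i _ =>
            mul_nonneg (by norm_num) (sliceGreen_nonneg ha hf k z)
  refine (ENNReal.ofReal_le_ofReal_iff ?_).1 hmain
  exact Finset.sum_nonneg fun z _ => Finset.prod_nonneg fun i _ =>
    mul_nonneg (by norm_num) (sliceGreen_nonneg ha hf k z)

end

/-- The average of `f` for a stationary measure is controlled by the sums of `f` along the walks
killed when they move in one of the coordinates. -/
lemma IsStationary.sum_le (hd : 0 < d) (hN : 0 < N) {ω : Env d} (hω : Balanced ω)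
    {Q : (Fin d → ℤ) → ℝ} (hQ : IsStationary ω N Q) {k : ℕ} (hk : k ≤ N)
    (hq : ∀ i, ∀ x ∈ cube d N, survival (foldKernel ω N) i k x ≤ 1 / 2)
    {f : (Fin d → ℤ) → ℝ} (hf : ∀ z, 0 ≤ f z) (hff : ∀ z, f (fold N z) = f z) :
    (∑ x ∈ cube d N, Q x * f x) ^ d ≤ (60 * d / N) ^ d *
      ∑ x ∈ cube d N, ∑ i, sliceGreen (foldKernel ω N) i k f x ^ d := by
  have ha := hω.isBalancedKernel N
  have hN' : (0 : ℝ) < N := by exact_mod_cast hN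
  have hd' : (0 : ℝ) < d := by exact_mod_cast hd
  set a := foldKernel ω N with hadef
  -- The killing rate matches the diffusive time scale of the cube.
  set l : ℝ := 1 / (N : ℝ) ^ 2 with hl
  have hl0 : 0 < l := by positivity
  obtain ⟨v, hvf, hv⟩ := exists_resolvent hN hω hl0 f
  simp only [hff] at hv
  have hQv : ∑ x ∈ cube d N, Q x * f x = l * ∑ x ∈ cube d N, Q x * v x := by
    have h1 := hQ.sum_step hN hvf
    have h2 : ∑ x ∈ cube d N, Q x * f x = (1 + l) * ∑ x ∈ cube d N, Q x * v x -
        ∑ x ∈ cube d N, Q x * step (foldKernel ω N) v x := by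
      rw [Finset.mul_sum, ← Finset.sum_sub_distrib]
      refine Finset.sum_congr rfl fun x _ => ?_
      rw [hv]; ring
    rw [h2, h1]; ring
  have hQf : 0 ≤ ∑ x ∈ cube d N, Q x * f x :=
    Finset.sum_nonneg fun x _ => mul_nonneg (hQ.nonneg x) (hf x)
  have hRHS : 0 ≤ ∑ x ∈ cube d N, ∑ i, sliceGreen a i k f x ^ d :=
    Finset.sum_nonneg fun x _ => Finset.sum_nonneg fun i _ =>
      pow_nonneg (sliceGreen_nonneg ha hf k x) d
  obtain ⟨x₀, hx₀, hmax⟩ := Finset.exists_max_image (cube d N) v ⟨_, fold_mem_cube hN 0⟩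
  have hmax' : ∀ z, v z ≤ v x₀ := fun z => by
    rw [← hvf]; exact hmax _ (fold_mem_cube hN z)
  set M := v x₀ with hM
  have hQM : ∑ x ∈ cube d N, Q x * f x ≤ l * M := by
    rw [hQv]
    gcongr
    calc ∑ x ∈ cube d N, Q x * v x ≤ ∑ x ∈ cube d N, Q x * M :=
          Finset.sum_le_sum fun x hx => mul_le_mul_of_nonneg_left (hmax x hx) (hQ.nonneg x)
      _ = M := by rw [← Finset.sum_mul, hQ.sum_eq_one, one_mul]
  rcases le_or_gt M 0 with hM0 | hM0
  · have h0 : ∑ x ∈ cube d N, Q x * f x = 0 := le_antisymm (hQM.trans (by nlinarith)) hQf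
    rw [h0, zero_pow hd.ne']
    positivity
  -- Subtracting `M * g` localizes `v`: `g` is `1/4` at `x₀`, so `3/4` of the maximum survives
  -- there, and at least `1` beyond distance `2N`, where `v - M * g` is not positive.
  set g : (Fin d → ℤ) → ℝ := fun z => 1 / 4 + l / 4 * ∑ j, ((z j : ℝ) - x₀ j) ^ 2 with hg
  have hgstep : ∀ z, step a g z = g z + l / 4 := by
    intro z
    have := ha.step_sq x₀ z
    simp only [step] at this
    simp only [step, hg, mul_add, Finset.sum_add_distrib, ← Finset.sum_mul, ha.sum_eq_one,
      mul_left_comm _ (l / 4), ← Finset.mul_sum, this]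
    ring
  have hg4 : ∀ z, 1 / 4 ≤ g z := fun z => by
    have : 0 ≤ ∑ j, ((z j : ℝ) - x₀ j) ^ 2 := Finset.sum_nonneg fun j _ => sq_nonneg _
    simp only [hg]
    have := mul_nonneg hl0.le this
    linarith
  set u : (Fin d → ℤ) → ℝ := fun z => max (v z - M * g z) 0 with hudef
  have hu0 : u x₀ = 3 / 4 * M := by
    have : g x₀ = 1 / 4 := by simp [hg]
    simp only [hudef, this, ← hM]
    rw [max_eq_left (by linarith)]; ring
  have hustep : ∀ z, u z ≤ f z + step a u z := by
    intro z
    have h1 : 0 ≤ step a u z :=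
      Finset.sum_nonneg fun e _ => mul_nonneg (ha.nonneg _ _) (le_max_right _ _)
    refine max_le ?_ (add_nonneg (hf z) h1)
    rcases le_or_gt (v z - M * g z) 0 with h2 | h2
    · exact h2.trans (add_nonneg (hf z) h1)
    have h3 : step a v z - M * step a g z ≤ step a u z := by
      simp only [step, Finset.mul_sum, ← Finset.sum_sub_distrib]
      refine Finset.sum_le_sum fun e _ => ?_
      have : a z e * (v (z + e.vec) - M * g (z + e.vec)) ≤ a z e * u (z + e.vec) :=
        mul_le_mul_of_nonneg_left (le_max_left _ _) (ha.nonneg _ _)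
      linarith
    rw [hgstep, hv] at h3
    -- The step operator adds `M * l / 4` to `M * g`. Where `u > 0` the resolvent term `l * v z`
    -- compensates for this, because there `v z > M * g z ≥ M / 4`.
    have h4 : M * (1 / 4) ≤ v z := by
      have := mul_le_mul_of_nonneg_left (hg4 z) hM0.le
      linarith
    have h5 := mul_le_mul_of_nonneg_left h4 hl0.le
    linarith
  have husupp : ∀ z, (¬ ∀ j, |z j - x₀ j| ≤ 2 * (N : ℤ)) → u z = 0 := by
    intro z hz
    push Not at hz
    obtain ⟨j, hj⟩ := hz
    refine max_eq_right ?_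
    have h1 : (2 * (N : ℝ)) ^ 2 ≤ ((z j : ℝ) - x₀ j) ^ 2 := by
      have h2 : 2 * (N : ℝ) ≤ |(z j : ℝ) - x₀ j| := by exact_mod_cast hj.le
      rw [← sq_abs ((z j : ℝ) - x₀ j)]
      gcongr
    have h2 : ((z j : ℝ) - x₀ j) ^ 2 ≤ ∑ j, ((z j : ℝ) - x₀ j) ^ 2 :=
      Finset.single_le_sum (f := fun j => ((z j : ℝ) - x₀ j) ^ 2) (fun j _ => sq_nonneg _)
        (Finset.mem_univ j)
    have h3 : 1 ≤ g z := by
      have h4 : l / 4 * (2 * (N : ℝ)) ^ 2 = 1 := by rw [hl]; field_simp; norm_num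
      have h5 := mul_le_mul_of_nonneg_left (h1.trans h2) (by positivity : 0 ≤ l / 4)
      simp only [hg]; linarith
    have h6 := hmax' z
    nlinarith
  have habp := ha.maximum_principle hd hN hk hf hustep husupp (by rw [hu0]; positivity)
    fun i z => by rw [hadef, ← survival_fold hN hω]; exact hq i _ (fold_mem_cube hN z)
  have hB : ∑ z ∈ Fintype.piFinset fun j => Finset.Icc (x₀ j - 2 * N) (x₀ j + 2 * N),
        ∏ i, 4 * sliceGreen a i k f z ≤
      5 ^ d * ∑ x ∈ cube d N, 4 ^ d * ∑ i, sliceGreen a i k f x ^ d := by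
    have h1 : ∀ z, ∏ i, 4 * sliceGreen a i k f z ≤
        4 ^ d * ∑ i, sliceGreen a i k f (fold N z) ^ d := by
      intro z
      simp only [hadef, sliceGreen_fold hN hω _ _ hff]
      rw [Finset.prod_mul_distrib, Finset.prod_const, Finset.card_univ, Fintype.card_fin]
      gcongr
      have : Nonempty (Fin d) := ⟨⟨0, hd⟩⟩
      obtain ⟨m, hm⟩ := Finite.exists_max fun i => sliceGreen (foldKernel ω N) i k f z
      calc ∏ i, sliceGreen (foldKernel ω N) i k f z
          ≤ ∏ _i : Fin d, sliceGreen (foldKernel ω N) m k f z :=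
            Finset.prod_le_prod (fun i _ => sliceGreen_nonneg ha hf k z) fun i _ => hm i
        _ = sliceGreen (foldKernel ω N) m k f z ^ d := by simp
        _ ≤ _ := Finset.single_le_sum (f := fun i => sliceGreen (foldKernel ω N) i k f z ^ d)
            (fun i _ => pow_nonneg (sliceGreen_nonneg ha hf k z) d) (Finset.mem_univ m)
    refine (Finset.sum_le_sum fun z _ => h1 z).trans ?_
    refine sum_fold_le hN (h := fun x => 4 ^ d * ∑ i, sliceGreen a i k f x ^ d) ?_ fun x => ?_
    · intro z hz j
      have h2 := Finset.mem_Icc.1 (Fintype.mem_piFinset.1 hz j)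
      have h3 := mem_cube.1 hx₀ j
      constructor <;> linarith [h2.1, h2.2, h3.1, h3.2]
    · exact mul_nonneg (by positivity) (Finset.sum_nonneg fun i _ =>
        pow_nonneg (sliceGreen_nonneg ha hf k x) d)
  rw [hu0] at habp
  rw [← Finset.mul_sum] at hB
  have hfinal := habp.trans hB
  set S := ∑ x ∈ cube d N, ∑ i, sliceGreen a i k f x ^ d
  calc (∑ x ∈ cube d N, Q x * f x) ^ d ≤ (l * M) ^ d := pow_le_pow_left₀ hQf hQM d
    _ = (8 * d / (3 * N)) ^ d * (3 / 4 * M / (2 * d * N)) ^ d := by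
        rw [← mul_pow]; congr 1; rw [hl]; field_simp; norm_num
    _ ≤ (8 * d / (3 * N)) ^ d * (5 ^ d * (4 ^ d * S)) := by gcongr
    _ = (160 / 3 * d / N) ^ d * S := by
        rw [← mul_assoc, ← mul_assoc, ← mul_pow, ← mul_pow]; congr 2; field_simp; norm_num
    _ ≤ _ := by gcongr; norm_num

/-! ### ### From survival probabilities to norms of `sliceGreen` -/

/-- The sup-norm ball of radius `t` around `x`. -/
def box (x : Fin d → ℤ) (t : ℕ) : Finset (Fin d → ℤ) :=
  Fintype.piFinset fun j => Finset.Icc (x j - t) (x j + t)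

lemma mem_box {x y : Fin d → ℤ} {t : ℕ} : y ∈ box x t ↔ ∀ j, |y j - x j| ≤ t := by
  simp only [box, Fintype.mem_piFinset, Finset.mem_Icc, abs_le]
  exact forall_congr' fun j => by constructor <;> rintro ⟨h1, h2⟩ <;> constructor <;> linarith

lemma card_box (x : Fin d → ℤ) (t : ℕ) : (box x t).card = (2 * t + 1) ^ d := by
  rw [box, Fintype.card_piFinset]
  simp only [Int.card_Icc]
  rw [Finset.prod_congr rfl (g := fun _ => 2 * t + 1) fun j _ => by omega]
  simp

/-- The value at `x` after `t` killed steps is at most the survival probability times the maximum of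
`f` over the box of radius `t`, and that maximum is bounded by an `ℓ^(d s)` norm over the box.
Hölder separates the two factors. The loss of the box volume is affordable because survival decays
faster than any power. -/
lemma sum_iterate_pow_le (hd : 0 < d) (hN : 0 < N) {ω : Env d} (hω : Balanced ω) (i : Fin d)
    {r s : ℝ} (hrs : r.HolderConjugate s) {f : (Fin d → ℤ) → ℝ} (hf : ∀ z, 0 ≤ f z)
    (hff : ∀ z, f (fold N z) = f z) {t : ℕ} (ht : t ≤ N) :
    ∑ x ∈ cube d N, (sliceStep (foldKernel ω N) i)^[t] f x ^ d ≤
      (∑ x ∈ cube d N, survival (foldKernel ω N) i t x) ^ (1 / r) *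
      ((2 * t + 1) ^ d * (5 ^ d * ∑ x ∈ cube d N, f x ^ (d * s))) ^ (1 / s) := by
  have ha := hω.isBalancedKernel N
  have hs0 : 0 < s := hrs.symm.pos
  have hd' : (0 : ℝ) < d := by exact_mod_cast hd
  have hq0 : 0 < d * s := by positivity
  let W : (Fin d → ℤ) → ℝ := fun x => ∑ w ∈ box (0 : Fin d → ℤ) t, f (x + w) ^ (d * s)
  have hW0 : ∀ x, 0 ≤ W x := fun x => Finset.sum_nonneg fun w _ => Real.rpow_nonneg (hf _) _
  have hS0 : ∀ x, 0 ≤ survival (foldKernel ω N) i t x := fun x => survival_nonneg ha t x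
  have hS1 : ∀ x, survival (foldKernel ω N) i t x ≤ 1 := fun x => survival_le_one ha t x
  have h1 : ∀ x, (sliceStep (foldKernel ω N) i)^[t] f x ^ d ≤
      survival (foldKernel ω N) i t x * W x ^ (1 / s) := by
    intro x
    have h2 : (sliceStep (foldKernel ω N) i)^[t] f x ≤
        W x ^ (1 / (d * s)) * survival (foldKernel ω N) i t x := by
      refine iterate_sliceStep_le ha t x fun y hy => ?_
      have h3 : f y ^ (d * s) ≤ W x := by
        have := Finset.single_le_sum (s := box (0 : Fin d → ℤ) t)
          (f := fun w => f (x + w) ^ (d * s)) (fun w _ => Real.rpow_nonneg (hf _) _)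
          (show y - x ∈ box (0 : Fin d → ℤ) t from mem_box.2 fun j => by simpa using hy j)
        simpa using this
      calc f y = (f y ^ (d * s)) ^ (1 / (d * s)) := by
            rw [← Real.rpow_mul (hf y), mul_one_div_cancel hq0.ne', Real.rpow_one]
        _ ≤ _ := Real.rpow_le_rpow (Real.rpow_nonneg (hf y) _) h3 (by positivity)
    calc (sliceStep (foldKernel ω N) i)^[t] f x ^ d
        ≤ (W x ^ (1 / (d * s)) * survival (foldKernel ω N) i t x) ^ d :=
          pow_le_pow_left₀ (iterate_sliceStep_nonneg ha hf t x) h2 d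
      _ = survival (foldKernel ω N) i t x ^ d * W x ^ (1 / s) := by
          rw [mul_pow, mul_comm, ← Real.rpow_natCast (W x ^ _), ← Real.rpow_mul (hW0 x)]
          congr 2; field_simp
      _ ≤ _ := by
          gcongr
          · exact Real.rpow_nonneg (hW0 x) _
          · exact pow_le_of_le_one (hS0 x) (hS1 x) hd.ne'
  have h2 := Real.inner_le_Lp_mul_Lq_of_nonneg (cube d N) hrs
    (f := fun x => survival (foldKernel ω N) i t x) (g := fun x => W x ^ (1 / s))
    (fun x _ => hS0 x) (fun x _ => Real.rpow_nonneg (hW0 x) _)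
  have h3 : ∀ x, (W x ^ (1 / s)) ^ s = W x := fun x => by
    rw [← Real.rpow_mul (hW0 x), one_div_mul_cancel hs0.ne', Real.rpow_one]
  simp only [h3] at h2
  have h4 : ∑ x ∈ cube d N, W x ≤
      (2 * t + 1) ^ d * (5 ^ d * ∑ x ∈ cube d N, f x ^ (d * s)) := by
    simp only [W]
    rw [Finset.sum_comm]
    have h5 : ∀ w ∈ box (0 : Fin d → ℤ) t, ∑ x ∈ cube d N, f (x + w) ^ (d * s) ≤
        5 ^ d * ∑ x ∈ cube d N, f x ^ (d * s) := by
      intro w hw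
      have h6 : ∑ x ∈ cube d N, f (x + w) ^ (d * s) =
          ∑ z ∈ (cube d N).image (· + w), f (fold N z) ^ (d * s) := by
        rw [Finset.sum_image fun x _ y _ h => add_right_cancel h]
        simp only [hff]
      rw [h6]
      refine sum_fold_le hN (h := fun x => f x ^ (d * s)) ?_ fun x => Real.rpow_nonneg (hf x) _
      intro z hz j
      obtain ⟨x, hx, rfl⟩ := Finset.mem_image.1 hz
      have h7 := mem_cube.1 hx j
      have h8 := abs_le.1 (mem_box.1 hw j)
      have h9 : (t : ℤ) ≤ N := by exact_mod_cast ht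
      simp only [Pi.zero_apply, sub_zero, Pi.add_apply] at h8 ⊢
      constructor <;> linarith [h7.1, h7.2, h8.1, h8.2]
    refine (Finset.sum_le_sum h5).trans ?_
    rw [Finset.sum_const, card_box, nsmul_eq_mul]
    push_cast
    exact le_rfl
  have hr1 := hrs.lt
  refine (Finset.sum_le_sum fun x _ => h1 x).trans (h2.trans ?_)
  have hr0 : 0 < r := hrs.pos
  have h5 : ∑ x ∈ cube d N, survival (foldKernel ω N) i t x ^ r ≤
      ∑ x ∈ cube d N, survival (foldKernel ω N) i t x :=
    Finset.sum_le_sum fun x _ => by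
      simpa using Real.rpow_le_rpow_of_exponent_ge_of_imp (hS0 x) (hS1 x) hr1.le (by
        intro _ h; exact absurd h hr0.ne')
  have h6 : 0 ≤ ∑ x ∈ cube d N, survival (foldKernel ω N) i t x ^ r :=
    Finset.sum_nonneg fun x _ => Real.rpow_nonneg (hS0 x) _
  have h7 : 0 ≤ ∑ x ∈ cube d N, W x := Finset.sum_nonneg fun x _ => hW0 x
  gcongr
  exact Real.rpow_nonneg (h6.trans h5) _

/-- A telescoping sum: these are convenient summable weights of total mass below `1`, independent of
the horizon. -/
lemma sum_range_weight (k : ℕ) :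
    ∑ t ∈ Finset.range k, 1 / (((t : ℝ) + 1) * (t + 2)) = 1 - 1 / ((k : ℝ) + 1) := by
  induction k with
  | zero => simp
  | succ k ih =>
    rw [Finset.sum_range_succ, ih]
    push_cast
    field_simp
    ring

/-- With weights of total mass below `1`, a sum is at most the largest reweighted term, whose `d`-th
power is one of the terms on the right. -/
lemma sliceGreen_pow_le {a : (Fin d → ℤ) → Dir d → ℝ} (ha : IsBalancedKernel a) (hd : 0 < d)
    (i : Fin d) (k : ℕ) {f : (Fin d → ℤ) → ℝ} (hf : ∀ z, 0 ≤ f z) (x : Fin d → ℤ) :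
    sliceGreen a i k f x ^ d ≤
      ∑ t ∈ Finset.range k, (((t : ℝ) + 1) * (t + 2)) ^ d * (sliceStep a i)^[t] f x ^ d := by
  rcases Nat.eq_zero_or_pos k with rfl | hk
  · simp [sliceGreen, hd.ne']
  obtain ⟨m, hm, hmax⟩ := Finset.exists_max_image (Finset.range k)
    (fun t : ℕ => ((t : ℝ) + 1) * (t + 2) * (sliceStep a i)^[t] f x)
    ⟨0, Finset.mem_range.2 hk⟩
  have h0 : ∀ t : ℕ, 0 ≤ ((t : ℝ) + 1) * (t + 2) * (sliceStep a i)^[t] f x := fun t =>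
    mul_nonneg (by positivity) (iterate_sliceStep_nonneg ha hf t x)
  have h1 : sliceGreen a i k f x ≤ ((m : ℝ) + 1) * (m + 2) * (sliceStep a i)^[m] f x := by
    calc sliceGreen a i k f x = ∑ t ∈ Finset.range k, 1 / (((t : ℝ) + 1) * (t + 2)) *
          (((t : ℝ) + 1) * (t + 2) * (sliceStep a i)^[t] f x) := by
          refine Finset.sum_congr rfl fun t _ => ?_
          field_simp
      _ ≤ ∑ t ∈ Finset.range k, 1 / (((t : ℝ) + 1) * (t + 2)) *
          (((m : ℝ) + 1) * (m + 2) * (sliceStep a i)^[m] f x) :=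
          Finset.sum_le_sum fun t ht => mul_le_mul_of_nonneg_left (hmax t ht) (by positivity)
      _ = (1 - 1 / ((k : ℝ) + 1)) * (((m : ℝ) + 1) * (m + 2) * (sliceStep a i)^[m] f x) := by
          rw [← Finset.sum_mul, sum_range_weight]
      _ ≤ 1 * (((m : ℝ) + 1) * (m + 2) * (sliceStep a i)^[m] f x) := by
          gcongr
          · exact h0 m
          · have : 0 ≤ 1 / ((k : ℝ) + 1) := by positivity
            linarith
      _ = _ := one_mul _
  refine (pow_le_pow_left₀ (sliceGreen_nonneg ha hf k x) h1 d).trans ?_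
  rw [mul_pow]
  exact Finset.single_le_sum
    (f := fun t : ℕ => (((t : ℝ) + 1) * (t + 2)) ^ d * (sliceStep a i)^[t] f x ^ d)
    (fun t _ => mul_nonneg (by positivity)
      (pow_nonneg (iterate_sliceStep_nonneg ha hf t x) d)) hm

/-- Bookkeeping of powers of `T = t + 1`: the weight costs `T^(2d)`, the volume of the box at most
`T^d`, and `T^2` is kept for summability. So the survival average, raised to the power `1/r`, must
decay like `T^(-(3d+2))`, which is the condition on `c`. -/
lemma weighted_term_le (hN : 0 < N) {r s : ℝ} (hrs : r.HolderConjugate s)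
    {c : ℕ} (hc : r * (3 * d + 2) ≤ c) {C₀ A B : ℝ} (hC₀ : 0 ≤ C₀) (hB : 0 ≤ B) (t : ℕ)
    (hA0 : 0 ≤ A) (hA : A ≤ C₀ * N ^ d / (1 + t) ^ c) :
    (((t : ℝ) + 1) * (t + 2)) ^ d *
      (A ^ (1 / r) * ((2 * t + 1) ^ d * (5 ^ d * (N ^ d * B))) ^ (1 / s)) ≤
    N ^ d * (20 ^ d * C₀ ^ (1 / r) * B ^ (1 / s)) * (2 * (1 / (((t : ℝ) + 1) * (t + 2)))) := by
  have hr0 := hrs.pos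
  have hs0 := hrs.symm.pos
  have hsum : 1 / r + 1 / s = 1 := by
    have := hrs.inv_add_inv_eq_one; simpa [one_div] using this
  have hs1 : 1 / s ≤ 1 := by
    have : 0 < 1 / r := by positivity
    linarith
  set T : ℝ := (t : ℝ) + 1 with hT
  have hT1 : 1 ≤ T := by simp [hT]
  have hT0 : 0 < T := by linarith
  have hNN : (0 : ℝ) < (N : ℝ) ^ d := by positivity
  have h1 : A ^ (1 / r) ≤ C₀ ^ (1 / r) * ((N : ℝ) ^ d) ^ (1 / r) / T ^ (3 * d + 2) := by
    have h2 : (T ^ c) ^ (1 / r) ≥ T ^ (3 * d + 2) := by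
      rw [← Real.rpow_natCast, ← Real.rpow_natCast, ← Real.rpow_mul hT0.le]
      refine Real.rpow_le_rpow_of_exponent_le hT1 ?_
      push_cast
      rw [mul_one_div, le_div_iff₀ hr0]
      linarith
    calc A ^ (1 / r) ≤ (C₀ * N ^ d / T ^ c) ^ (1 / r) :=
          Real.rpow_le_rpow hA0 (by rw [hT, add_comm (t : ℝ) 1]; exact hA) (by positivity)
      _ = C₀ ^ (1 / r) * ((N : ℝ) ^ d) ^ (1 / r) / (T ^ c) ^ (1 / r) := by
          rw [Real.div_rpow (by positivity) (by positivity), Real.mul_rpow hC₀ hNN.le]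
      _ ≤ _ := by gcongr
  have h2 : ((2 * t + 1) ^ d * (5 ^ d * (N ^ d * B))) ^ (1 / s) ≤
      (10 * T) ^ d * (((N : ℝ) ^ d) ^ (1 / s) * B ^ (1 / s)) := by
    have h3 : (2 * (t : ℝ) + 1) ^ d * (5 ^ d * (N ^ d * B)) ≤ (10 * T) ^ d * (N ^ d * B) := by
      have h4 : (2 * (t : ℝ) + 1) * 5 ≤ 10 * T := by rw [hT]; linarith
      rw [← mul_assoc, ← mul_pow]
      exact mul_le_mul_of_nonneg_right (pow_le_pow_left₀ (by positivity) h4 d) (by positivity)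
    calc ((2 * (t : ℝ) + 1) ^ d * (5 ^ d * (N ^ d * B))) ^ (1 / s)
        ≤ ((10 * T) ^ d * (N ^ d * B)) ^ (1 / s) :=
          Real.rpow_le_rpow (by positivity) h3 (by positivity)
      _ = ((10 * T) ^ d) ^ (1 / s) * (((N : ℝ) ^ d) ^ (1 / s) * B ^ (1 / s)) := by
          rw [Real.mul_rpow (by positivity) (by positivity), Real.mul_rpow hNN.le hB]
      _ ≤ _ := by
          gcongr
          have h4 : 1 ≤ (10 * T) ^ d := one_le_pow₀ (by linarith)
          simpa using Real.rpow_le_rpow_of_exponent_le h4 hs1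
  have h3 : ((N : ℝ) ^ d) ^ (1 / r) * ((N : ℝ) ^ d) ^ (1 / s) = (N : ℝ) ^ d := by
    rw [← Real.rpow_add hNN, hsum, Real.rpow_one]
  have hA' : 0 ≤ A ^ (1 / r) := Real.rpow_nonneg hA0 _
  have hC' : 0 ≤ C₀ ^ (1 / r) := Real.rpow_nonneg hC₀ _
  have hB' : 0 ≤ B ^ (1 / s) := Real.rpow_nonneg hB _
  have hN1 : 0 ≤ ((N : ℝ) ^ d) ^ (1 / r) := Real.rpow_nonneg hNN.le _
  have hN2 : 0 ≤ ((N : ℝ) ^ d) ^ (1 / s) := Real.rpow_nonneg hNN.le _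
  have hT2 : (t : ℝ) + 2 ≤ 2 * T := by rw [hT]; linarith
  calc (T * (t + 2)) ^ d *
      (A ^ (1 / r) * ((2 * t + 1) ^ d * (5 ^ d * (N ^ d * B))) ^ (1 / s))
      ≤ (T * (2 * T)) ^ d * (C₀ ^ (1 / r) * ((N : ℝ) ^ d) ^ (1 / r) / T ^ (3 * d + 2) *
        ((10 * T) ^ d * (((N : ℝ) ^ d) ^ (1 / s) * B ^ (1 / s)))) := by gcongr
    _ = (((N : ℝ) ^ d) ^ (1 / r) * ((N : ℝ) ^ d) ^ (1 / s)) *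
        (20 ^ d * C₀ ^ (1 / r) * B ^ (1 / s)) * (1 / T ^ 2) := by
        rw [show T ^ (3 * d + 2) = T ^ d * T ^ d * T ^ d * T ^ 2 by ring,
          show (20 : ℝ) ^ d = 2 ^ d * 10 ^ d by rw [← mul_pow]; norm_num,
          mul_pow T, mul_pow 2 T, mul_pow 10 T]
        field_simp
    _ ≤ _ := by
        rw [h3]
        gcongr
        rw [mul_one_div, div_le_div_iff₀ (by positivity) (by positivity)]
        nlinarith

lemma sum_sliceGreen_pow_le (hd : 0 < d) (hN : 0 < N) {ω : Env d} (hω : Balanced ω) (i : Fin d)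
    {r s : ℝ} (hrs : r.HolderConjugate s) {c : ℕ} (hc : r * (3 * d + 2) ≤ c) {C₀ : ℝ}
    (hC₀ : 0 ≤ C₀) {k : ℕ} (hk : k ≤ N)
    (hS : ∀ t < k, ∑ x ∈ cube d N, survival (foldKernel ω N) i t x ≤ C₀ * N ^ d / (1 + t) ^ c)
    {f : (Fin d → ℤ) → ℝ} (hf : ∀ z, 0 ≤ f z) (hff : ∀ z, f (fold N z) = f z) :
    ∑ x ∈ cube d N, sliceGreen (foldKernel ω N) i k f x ^ d ≤
      N ^ d * (2 * 20 ^ d * C₀ ^ (1 / r) *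
        (1 / (N : ℝ) ^ d * ∑ x ∈ cube d N, f x ^ (d * s)) ^ (1 / s)) := by
  have ha := hω.isBalancedKernel N
  have hNN : (0 : ℝ) < (N : ℝ) ^ d := by positivity
  set B := 1 / (N : ℝ) ^ d * ∑ x ∈ cube d N, f x ^ (d * s) with hBdef
  have hB : 0 ≤ B := mul_nonneg (by positivity)
    (Finset.sum_nonneg fun x _ => Real.rpow_nonneg (hf x) _)
  have hB1 : ∑ x ∈ cube d N, f x ^ (d * s) = N ^ d * B := by rw [hBdef]; field_simp
  have hB' : 0 ≤ B ^ (1 / s) := Real.rpow_nonneg hB _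
  have hC' : 0 ≤ C₀ ^ (1 / r) := Real.rpow_nonneg hC₀ _
  calc ∑ x ∈ cube d N, sliceGreen (foldKernel ω N) i k f x ^ d
      ≤ ∑ x ∈ cube d N, ∑ t ∈ Finset.range k, (((t : ℝ) + 1) * (t + 2)) ^ d *
          (sliceStep (foldKernel ω N) i)^[t] f x ^ d :=
        Finset.sum_le_sum fun x _ => sliceGreen_pow_le ha hd i k hf x
    _ = ∑ t ∈ Finset.range k, (((t : ℝ) + 1) * (t + 2)) ^ d *
          ∑ x ∈ cube d N, (sliceStep (foldKernel ω N) i)^[t] f x ^ d := by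
        rw [Finset.sum_comm]; simp only [Finset.mul_sum]
    _ ≤ ∑ t ∈ Finset.range k, N ^ d * (20 ^ d * C₀ ^ (1 / r) * B ^ (1 / s)) *
          (2 * (1 / (((t : ℝ) + 1) * (t + 2)))) := by
        refine Finset.sum_le_sum fun t ht => ?_
        have htk := Finset.mem_range.1 ht
        have h1 := sum_iterate_pow_le hd hN hω i hrs hf hff (htk.le.trans hk)
        rw [hB1] at h1
        refine (mul_le_mul_of_nonneg_left h1 (by positivity)).trans ?_
        exact weighted_term_le hN hrs hc hC₀ hB t
          (Finset.sum_nonneg fun x _ => survival_nonneg ha t x) (hS t htk)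
    _ = N ^ d * (20 ^ d * C₀ ^ (1 / r) * B ^ (1 / s)) * (2 * (1 - 1 / ((k : ℝ) + 1))) := by
        rw [← Finset.mul_sum, ← Finset.mul_sum, sum_range_weight]
    _ ≤ N ^ d * (20 ^ d * C₀ ^ (1 / r) * B ^ (1 / s)) * (2 * 1) := by
        gcongr
        have : 0 ≤ 1 / ((k : ℝ) + 1) := by positivity
        linarith
    _ = _ := by ring

/-! ### ### Duality -/

lemma density_eq (N : ℕ) (Q : (Fin d → ℤ) → ℝ) (x : Fin d → ℤ) :
    density N Q x = Q x * N ^ d := by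
  rw [density, uniformMass, card_cube]; simp

/-- Good control of the survival probabilities in an environment bounds the densities of all
stationary measures. -/
lemma exists_cubeNorm_density_lt (hd : 2 ≤ d) {p' : ℝ} (h1 : 1 < p')
    (hp : p' < (d : ℝ) / ((d : ℝ) - 1)) : ∃ c : ℕ, ∀ C₀ : ℝ, 0 ≤ C₀ → ∃ C : ℝ,
    ∀ (N : ℕ) (ω : Env d) (k : ℕ), 0 < N → Balanced ω → k ≤ N →
      (∀ i, ∀ x ∈ cube d N, survival (foldKernel ω N) i k x ≤ 1 / 2) →
      (∀ i, ∀ t < k, ∑ x ∈ cube d N, survival (foldKernel ω N) i t x ≤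
        C₀ * N ^ d / (1 + t) ^ c) →
      ∀ Q, IsStationary ω N Q → cubeNorm N p' (density N Q) < C := by
  have hd' : (2 : ℝ) ≤ d := by exact_mod_cast hd
  have hd0 : 0 < d := by omega
  set q := p' / (p' - 1) with hq
  have hp1 : 0 < p' - 1 := by linarith
  -- The condition `p' < d / (d - 1)` says exactly that the conjugate exponent `q` exceeds `d`; this
  -- leaves room for Hölder with `s = q / d > 1`.
  have hqd : 1 < q / d := by
    rw [lt_div_iff₀ (by linarith)] at hp
    rw [hq, lt_div_iff₀ (by linarith), lt_div_iff₀ hp1]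
    linarith
  set s := q / d with hs
  have hds : d * s = q := by rw [hs]; field_simp
  have hrs : (Real.conjExponent s).HolderConjugate s := (Real.HolderConjugate.conjExponent hqd).symm
  set r := Real.conjExponent s
  refine ⟨⌈r * (3 * d + 2)⌉₊, fun C₀ hC₀ => ?_⟩
  set K := (60 * (d : ℝ)) ^ d * (d * (2 * 20 ^ d * C₀ ^ (1 / r))) with hK
  have hK0 : 0 ≤ K := by
    have : 0 ≤ C₀ ^ (1 / r) := Real.rpow_nonneg hC₀ _
    positivity
  refine ⟨K ^ (1 / (d : ℝ)) + 1, fun N ω k hN hω hk hhalf hS Q hQ => ?_⟩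
  have ha := hω.isBalancedKernel N
  have hNN : (0 : ℝ) < (N : ℝ) ^ d := by positivity
  have hD0 : ∀ x, 0 ≤ density N Q x := fun x => by
    rw [density_eq]; exact mul_nonneg (hQ.nonneg x) hNN.le
  -- The extremal function of `L^p'`–`L^q` duality: both `∫ f dQ` and the average of `f^q` equal
  -- `A`, the average of the `p'`-th power of the density.
  let f : (Fin d → ℤ) → ℝ := fun z => density N Q (fold N z) ^ (p' - 1)
  have hf : ∀ z, 0 ≤ f z := fun z => Real.rpow_nonneg (hD0 _) _
  have hff : ∀ z, f (fold N z) = f z := fun z => by simp only [f, fold_fold hN]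
  set A := 1 / (N : ℝ) ^ d * ∑ x ∈ cube d N, density N Q x ^ p' with hA
  have hA0 : 0 ≤ A := mul_nonneg (by positivity)
    (Finset.sum_nonneg fun x _ => Real.rpow_nonneg (hD0 x) _)
  have hQf : ∑ x ∈ cube d N, Q x * f x = A := by
    rw [hA, Finset.mul_sum]
    refine Finset.sum_congr rfl fun x hx => ?_
    have h3 : density N Q x ^ p' = density N Q x * density N Q x ^ (p' - 1) := by
      rcases (hD0 x).eq_or_lt with h | h
      · rw [← h, Real.zero_rpow (by linarith), zero_mul]
      · rw [Real.rpow_sub_one h.ne']; field_simp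
    simp only [f, fold_of_mem hx]
    rw [h3]
    nth_rewrite 2 [density_eq]
    field_simp
  have hfq : 1 / (N : ℝ) ^ d * ∑ x ∈ cube d N, f x ^ (d * s) = A := by
    rw [hA]
    congr 1
    refine Finset.sum_congr rfl fun x hx => ?_
    simp only [f, fold_of_mem hx]
    rw [← Real.rpow_mul (hD0 x), hds, hq]
    congr 1; field_simp
  have hbound := hQ.sum_le hd0 hN hω hk hhalf hf hff
  rw [hQf, Finset.sum_comm] at hbound
  have hsum : ∀ i ∈ (Finset.univ : Finset (Fin d)), ∑ x ∈ cube d N,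
      sliceGreen (foldKernel ω N) i k f x ^ d ≤
      N ^ d * (2 * 20 ^ d * C₀ ^ (1 / r) * A ^ (1 / s)) := fun i _ => by
    rw [← hfq]
    exact sum_sliceGreen_pow_le hd0 hN hω i hrs (Nat.le_ceil _) hC₀ hk (hS i) hf hff
  have hbound' : A ^ d ≤ K * A ^ (1 / s) := by
    refine (hbound.trans (mul_le_mul_of_nonneg_left (Finset.sum_le_sum hsum)
      (by positivity))).trans_eq ?_
    rw [Finset.sum_const, Finset.card_univ, Fintype.card_fin, nsmul_eq_mul, div_pow, hK]
    field_simp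
  have hnorm : cubeNorm N p' (density N Q) = A ^ (1 / p') := by
    rw [cubeNorm, card_cube, hA]
    simp only [abs_of_nonneg (hD0 _)]
  rw [hnorm]
  refine lt_of_le_of_lt ?_ (lt_add_one _)
  rcases hA0.eq_or_lt with h0 | hApos
  · rw [← h0, Real.zero_rpow (by positivity)]
    exact Real.rpow_nonneg hK0 _
  -- The finite quantity `A` is absorbed: `A^d ≤ K * A^(1/s)` and `d - 1/s = d/p'`.
  have h2 : A ^ ((d : ℝ) / p') ≤ K := by
    have h3 : (d : ℝ) / p' = d - 1 / s := by
      rw [hs, hq]; field_simp; ring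
    rw [h3, Real.rpow_sub hApos, Real.rpow_natCast, div_le_iff₀ (by positivity)]
    exact hbound'
  calc A ^ (1 / p') = (A ^ ((d : ℝ) / p')) ^ (1 / (d : ℝ)) := by
        rw [← Real.rpow_mul hA0]; congr 1; field_simp
    _ ≤ _ := Real.rpow_le_rpow (by positivity) h2 (by positivity)

instance (ν : Measure (SiteLaw d)) [IsProbabilityMeasure ν] : IsProbabilityMeasure (envLaw ν) := by
  unfold envLaw; infer_instance

/-! ### Independence -/

lemma indepFun_of_dependsOn (ν : Measure (SiteLaw d)) [IsProbabilityMeasure ν]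
    {f g : Env d → ℝ} (hf : Measurable f) (hg : Measurable g) {S T : Finset (Fin d → ℤ)}
    (hST : Disjoint S T) (hfS : DependsOn f (S : Set (Fin d → ℤ)))
    (hgT : DependsOn g (T : Set (Fin d → ℤ))) : IndepFun f g (envLaw ν) := by
  classical
  obtain ⟨m₀⟩ : Nonempty (SiteLaw d) := nonempty_of_isProbabilityMeasure ν
  -- A function depending only on `S` factors through the restriction to `S`; the arbitrary value
  -- `m₀` fills the other sites.
  let ext : (S : Finset (Fin d → ℤ)) → (S → SiteLaw d) → Env d :=
    fun S w z => if h : z ∈ S then w ⟨z, h⟩ else m₀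
  have hext : ∀ S, Measurable (ext S) := fun S => by
    refine measurable_pi_lambda _ fun z => ?_
    by_cases h : z ∈ S
    · simpa [ext, h] using measurable_pi_apply _
    · simp [ext, h]
  have hfac : ∀ {h : Env d → ℝ} {S : Finset (Fin d → ℤ)},
      DependsOn h (S : Set (Fin d → ℤ)) → h = (h ∘ ext S) ∘ fun ω (z : S) => ω z := by
    intro h S hS
    funext ω
    refine hS fun z hz => ?_
    simp [ext, Finset.mem_coe.1 hz]
  have hind : iIndepFun (fun (z : Fin d → ℤ) (ω : Env d) => ω z) (envLaw ν) :=
    iIndepFun_infinitePi (P := fun _ : Fin d → ℤ => ν) (X := fun _ m => m) fun _ => measurable_id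
  have h1 := hind.indepFun_finset S T hST fun z => measurable_pi_apply z
  rw [hfac hfS, hfac hgT]
  exact h1.comp (hf.comp (hext S)) (hg.comp (hext T))

lemma measurable_siteLaw_apply (e : Dir d) : Measurable fun m : SiteLaw d => m.1 e :=
  (measurable_pi_apply e).comp measurable_subtype_coe

lemma measurable_foldKernel (N : ℕ) (z : Fin d → ℤ) (e : Dir d) :
    Measurable fun ω : Env d => foldKernel ω N z e :=
  (measurable_siteLaw_apply e).comp (measurable_pi_apply (fold N z))

lemma foldKernel_nonneg (ω : Env d) (z : Fin d → ℤ) (e : Dir d) : 0 ≤ foldKernel ω N z e :=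
  (ω (fold N z)).2.1 e

lemma sum_foldKernel (ω : Env d) (z : Fin d → ℤ) : ∑ e, foldKernel ω N z e = 1 :=
  (ω (fold N z)).2.2

lemma foldKernel_le_one (ω : Env d) (z : Fin d → ℤ) (e : Dir d) : foldKernel ω N z e ≤ 1 := by
  rw [← sum_foldKernel (N := N) ω z]
  exact Finset.single_le_sum (fun e _ => foldKernel_nonneg ω z e) (Finset.mem_univ e)

lemma dependsOn_foldKernel (z : Fin d → ℤ) (e : Dir d) :
    DependsOn (fun ω : Env d => foldKernel ω N z e) {fold N z} := fun ω ω' h => by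
  simp only [foldKernel, jump, h (fold N z) rfl]

lemma measurable_survival (N : ℕ) (i : Fin d) (t : ℕ) (z : Fin d → ℤ) :
    Measurable fun ω : Env d => survival (foldKernel ω N) i t z := by
  induction t generalizing z with
  | zero => exact measurable_const
  | succ t ih =>
    simp only [survival_succ, sliceStep]
    refine Finset.measurable_sum _ fun e _ => ?_
    split
    · exact measurable_const
    · exact (measurable_foldKernel N z e).mul (ih _)

lemma dependsOn_survival (N : ℕ) (i : Fin d) (t : ℕ) (z : Fin d → ℤ) :
    DependsOn (fun ω : Env d => survival (foldKernel ω N) i t z)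
      ((box z t).image (fold N) : Finset (Fin d → ℤ)) := by
  induction t generalizing z with
  | zero => intro ω ω' _; rfl
  | succ t ih =>
    intro ω ω' h
    simp only [survival_succ, sliceStep]
    refine Finset.sum_congr rfl fun e _ => ?_
    split
    · rfl
    · congr 1
      · refine dependsOn_foldKernel z e fun y hy => h y ?_
        rw [Set.mem_singleton_iff.1 hy]
        exact Finset.mem_coe.2 (Finset.mem_image_of_mem _ (mem_box.2 fun j => by simp; omega))
      · refine ih _ fun y hy => h y ?_
        obtain ⟨w, hw, rfl⟩ := Finset.mem_image.1 (Finset.mem_coe.1 hy)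
        refine Finset.mem_coe.2 (Finset.mem_image_of_mem _ (mem_box.2 fun j => ?_))
        have h1 := mem_box.1 hw j
        have h2 := e.abs_vec_le j
        rw [Pi.add_apply] at h1
        rw [abs_le] at *
        push_cast
        constructor <;> linarith [h1.1, h1.2, h2.1, h2.2]

lemma integral_foldKernel (ν : Measure (SiteLaw d)) [IsProbabilityMeasure ν] (z : Fin d → ℤ)
    (e : Dir d) : ∫ ω, foldKernel ω N z e ∂envLaw ν = ∫ m, m.1 e ∂ν := by
  have h := Measure.infinitePi_map_eval (fun _ : Fin d → ℤ => ν) (fold N z)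
  have h1 := integral_map (μ := Measure.infinitePi fun _ : Fin d → ℤ => ν)
    (measurable_pi_apply (fold N z)).aemeasurable
    (measurable_siteLaw_apply e).aestronglyMeasurable
  rw [h] at h1
  exact h1.symm

/-! ### The range of the walk -/

/-- `S` contains points on every hyperplane that a path from `x` to `z` crosses, after folding. -/
def Crosses (N : ℕ) (x : Fin d → ℤ) (S : Finset (Fin d → ℤ)) (z : Fin d → ℤ) : Prop :=
  ∀ j m, (x j ≤ m ∧ m < z j ∨ z j < m ∧ m ≤ x j) → ∃ s ∈ S, s j = fold₁ N m

lemma crosses_self (x : Fin d → ℤ) : Crosses N x ∅ x := fun j m h => by omega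

/-- A unit step from `z` leaves only hyperplanes through `z` itself. The end point of the path is
not required to be covered, so a site enters `S` only when the walk leaves it. -/
lemma Crosses.insert {x : Fin d → ℤ} {S : Finset (Fin d → ℤ)}
    {z : Fin d → ℤ} (h : Crosses N x S z) (e : Dir d) :
    Crosses N x (insert (fold N z) S) (z + e.vec) := by
  intro j m hm
  have h1 := abs_le.1 (e.abs_vec_le j)
  rw [Pi.add_apply] at hm
  by_cases hmz : m = z j
  · exact ⟨fold N z, Finset.mem_insert_self _ _, by rw [hmz]; rfl⟩
  · obtain ⟨s, hs, h2⟩ := h j m (by omega)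
    exact ⟨s, Finset.mem_insert_of_mem hs, h2⟩

/-- The `2n ≤ N` consecutive integers meet at most two blocks of length `N`, and folding is
injective on each, so they have at least `n` distinct folded values. -/
lemma le_card_of_forall_fold₁ (hN : 0 < N) {n : ℕ} (hn : 2 * n ≤ N) {S : Finset (Fin d → ℤ)}
    {j : Fin d} {b : ℤ} (h : ∀ m, b ≤ m → m < b + 2 * n → ∃ s ∈ S, s j = fold₁ N m) :
    n ≤ S.card := by
  classical
  have hN' : (0 : ℤ) < N := by exact_mod_cast hN
  have hnN : 2 * (n : ℤ) ≤ N := by exact_mod_cast hn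
  have h1 : (Finset.Ico b (b + 2 * n)).card ≤
      (S.image (fun s => s j) ×ˢ Finset.Icc (b / N) (b / N + 1)).card := by
    refine Finset.card_le_card_of_injOn (fun m => (fold₁ N m, m / N)) ?_ ?_
    · intro m hm
      have hm' := Finset.mem_Ico.1 (Finset.mem_coe.1 hm)
      obtain ⟨s, hs, h2⟩ := h m hm'.1 hm'.2
      refine Finset.mem_coe.2 (Finset.mem_product.2 ⟨Finset.mem_image.2 ⟨s, hs, h2⟩, ?_⟩)
      refine Finset.mem_Icc.2 ⟨Int.ediv_le_ediv hN' hm'.1, ?_⟩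
      have h3 : m / N ≤ (b + 1 * N) / N := Int.ediv_le_ediv hN' (by linarith [hm'.2])
      rwa [Int.add_mul_ediv_right _ _ hN'.ne'] at h3
    · intro x _ y _ hxy
      exact eq_of_fold₁_eq hN (congrArg Prod.fst hxy) (congrArg Prod.snd hxy)
  rw [Finset.card_product, Int.card_Ico, Int.card_Icc] at h1
  have h2 : (S.image fun s => s j).card ≤ S.card := Finset.card_image_le
  have h3 : (b / N + 1 + 1 - b / N).toNat = 2 := by omega
  rw [h3] at h1
  omega

lemma Crosses.abs_sub_lt (hN : 0 < N) {n : ℕ} (hn : 2 * n ≤ N) {x z : Fin d → ℤ}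
    {S : Finset (Fin d → ℤ)} (h : Crosses N x S z) (hS : S.card < n) (j : Fin d) :
    |z j - x j| < 2 * n := by
  by_contra! hlt
  refine absurd hS (not_lt.2 ?_)
  rcases le_abs.1 hlt with h1 | h1
  · exact le_card_of_forall_fold₁ hN hn (j := j) (b := x j) fun m h2 h3 => h j m (by omega)
  · exact le_card_of_forall_fold₁ hN hn (j := j) (b := x j - 2 * n + 1) fun m h2 h3 =>
      h j m (by omega)

/-! ### The annealed survival probability -/

lemma integrable_of_unit (ν : Measure (SiteLaw d)) [IsProbabilityMeasure ν] {g : Env d → ℝ}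
    (hg : Measurable g) {C : ℝ} (h0 : ∀ᵐ ω ∂envLaw ν, 0 ≤ g ω) (h1 : ∀ᵐ ω ∂envLaw ν, g ω ≤ C) :
    Integrable g (envLaw ν) := by
  refine Integrable.of_bound hg.aestronglyMeasurable C ?_
  filter_upwards [h0, h1] with ω h0 h1
  rwa [Real.norm_of_nonneg h0]

/-- The walk is explored step by step. `S` is the set of folded sites left so far, and `g` is the
quenched weight of the path, a function of the environment on `S` only. There are two ways to stay
alive: leave `n` distinct sites, each new one costing an independent factor `ρ`, or leave fewer than
`n`. In the second case the walk stays within distance `2n` of `x`, which the exit-time barrier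
makes exponentially unlikely on the time scale `n ^ 2`. -/
lemma integral_mul_survival_le (ν : Measure (SiteLaw d)) [IsProbabilityMeasure ν]
    (hν : ∀ᵐ ω ∂envLaw ν, Balanced ω) (hd : 0 < d) (hN : 0 < N) (i : Fin d) {n : ℕ}
    (hn : 0 < n) (hnN : 2 * n ≤ N) (x : Fin d → ℤ) {ρ : ℝ} (hρ0 : 0 ≤ ρ)
    (hρ : ∑ e : Dir d, (if e.1 = i then 0 else ∫ m, m.1 e ∂ν) ≤ ρ) (t : ℕ)
    (S : Finset (Fin d → ℤ)) (z : Fin d → ℤ) (g : Env d → ℝ) (hz : Crosses N x S z)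
    (hS : S.card < n) (hgm : Measurable g) (hg0 : ∀ ω, 0 ≤ g ω) (hg1 : ∀ ω, g ω ≤ 1)
    (hgS : DependsOn g (S : Set (Fin d → ℤ))) :
    ∫ ω, g ω * survival (foldKernel ω N) i t z ∂envLaw ν ≤
      (∫ ω, g ω ∂envLaw ν) * (ρ ^ (n - S.card) + (1 - 1 / (8 * d * n ^ 2)) ^ t *
        ((8 * d * n ^ 2 - ∑ j, ((z j : ℝ) - x j) ^ 2) / (4 * d * n ^ 2))) := by
  classical
  have hd' : (1 : ℝ) ≤ d := by exact_mod_cast hd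
  have hn' : (1 : ℝ) ≤ n := by exact_mod_cast hn
  set c : ℝ := 4 * d * n ^ 2 with hc
  have hc1 : 1 ≤ c := by
    have : (1 : ℝ) ≤ n ^ 2 := one_le_pow₀ hn'
    nlinarith
  rw [show (8 : ℝ) * d * n ^ 2 = 2 * c by rw [hc]; ring]
  set θ : ℝ := 1 - 1 / (2 * c) with hθ
  have hθ0 : 0 ≤ θ := by
    rw [hθ, sub_nonneg, div_le_one (by linarith)]; linarith
  -- The barrier: one step of a balanced walk lowers `φ` by exactly `1`. Since `φ ≤ 2 * c`, this is
  -- at least a contraction by `θ`, and `c ≤ φ` within distance `2n`.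
  set φ : (Fin d → ℤ) → ℝ := fun z => 2 * c - ∑ j, ((z j : ℝ) - x j) ^ 2 with hφ
  have hφle : ∀ z, φ z ≤ 2 * c := fun z => by
    have : 0 ≤ ∑ j, ((z j : ℝ) - x j) ^ 2 := Finset.sum_nonneg fun j _ => sq_nonneg _
    simp only [hφ]; linarith
  have hφge : ∀ z : Fin d → ℤ, (∀ j, |z j - x j| ≤ 2 * n) → c ≤ φ z := fun z hz => by
    have : ∑ j, ((z j : ℝ) - x j) ^ 2 ≤ ∑ _j : Fin d, (2 * (n : ℝ)) ^ 2 := by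
      refine Finset.sum_le_sum fun j _ => ?_
      rw [← sq_abs]
      have h1 : |(z j : ℝ) - x j| ≤ 2 * n := by exact_mod_cast hz j
      gcongr
    rw [Finset.sum_const, Finset.card_univ, Fintype.card_fin, nsmul_eq_mul] at this
    simp only [hφ]
    rw [hc] at *
    linarith
  change _ ≤ (∫ ω, g ω ∂envLaw ν) * (ρ ^ (n - S.card) + θ ^ t * (φ z / c))
  induction t generalizing S z g with
  | zero =>
    simp only [survival_zero, mul_one, pow_zero, one_mul]
    have h1 : 1 ≤ φ z / c := by
      rw [one_le_div (by linarith)]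
      exact hφge z fun j => (hz.abs_sub_lt hN hnN hS j).le
    have h2 : 0 ≤ ∫ ω, g ω ∂envLaw ν := integral_nonneg hg0
    have h3 : 0 ≤ ρ ^ (n - S.card) := pow_nonneg hρ0 _
    nlinarith
  | succ t ih =>
    set S' := insert (fold N z) S with hS'
    let gg : Dir d → Env d → ℝ := fun e ω => g ω * foldKernel ω N z e
    have hgg0 : ∀ e ω, 0 ≤ gg e ω := fun e ω => mul_nonneg (hg0 ω) (foldKernel_nonneg ω z e)
    have hgg1 : ∀ e ω, gg e ω ≤ 1 := fun e ω =>
      mul_le_one₀ (hg1 ω) (foldKernel_nonneg ω z e) (foldKernel_le_one ω z e)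
    have hggm : ∀ e, Measurable (gg e) := fun e => hgm.mul (measurable_foldKernel N z e)
    have hggi : ∀ e, Integrable (gg e) (envLaw ν) := fun e =>
      integrable_of_unit ν (hggm e) (.of_forall (hgg0 e)) (.of_forall (hgg1 e))
    have hggS : ∀ e, DependsOn (gg e) (S' : Set (Fin d → ℤ)) := fun e ω ω' h => by
      have h1 : foldKernel ω N z e = foldKernel ω' N z e :=
        dependsOn_foldKernel z e fun y hy => h y (by
          rw [Set.mem_singleton_iff.1 hy]; simp [hS'])
      simp only [gg]
      rw [hgS fun y hy => h y (by simp [hS', Finset.mem_coe.1 hy]), h1]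
    have hgq : ∀ e (y : Fin d → ℤ),
        Integrable (fun ω => gg e ω * survival (foldKernel ω N) i t y) (envLaw ν) := fun e y => by
      refine integrable_of_unit ν (C := 1) ((hggm e).mul (measurable_survival N i t y)) ?_ ?_
      · filter_upwards [hν] with ω hω
        exact mul_nonneg (hgg0 e ω) (survival_nonneg (hω.isBalancedKernel N) t y)
      · filter_upwards [hν] with ω hω
        exact mul_le_one₀ (hgg1 e ω) (survival_nonneg (hω.isBalancedKernel N) t y)
          (survival_le_one (hω.isBalancedKernel N) t y)
    have hzb := hz.abs_sub_lt hN hnN hS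
    have hφe : ∀ e : Dir d, 0 ≤ φ (z + e.vec) := fun e =>
      le_trans (by linarith) (hφge _ fun j => by
        have h1 := hzb j
        have h2 := e.abs_vec_le j
        rw [Pi.add_apply]
        rw [abs_lt] at h1
        rw [abs_le] at *
        constructor <;> omega)
    have hterm : ∀ e : Dir d, ∫ ω, gg e ω * survival (foldKernel ω N) i t (z + e.vec) ∂envLaw ν ≤
        (∫ ω, gg e ω ∂envLaw ν) * (ρ ^ (n - S'.card) + θ ^ t * (φ (z + e.vec) / c)) := by
      intro e
      rcases lt_or_ge S'.card n with h | h
      · exact ih S' _ (gg e) (hz.insert e) h (hggm e) (hgg0 e) (hgg1 e) (hggS e)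
      -- The `n`-th site has just been left: the factor `ρ ^ 0 = 1` already dominates survival.
      · have h1 : ∫ ω, gg e ω * survival (foldKernel ω N) i t (z + e.vec) ∂envLaw ν ≤
            ∫ ω, gg e ω ∂envLaw ν := by
          refine integral_mono_ae (hgq e _) (hggi e) ?_
          filter_upwards [hν] with ω hω
          exact mul_le_of_le_one_right (hgg0 e ω) (survival_le_one (hω.isBalancedKernel N) t _)
        refine h1.trans (le_mul_of_one_le_right (integral_nonneg (hgg0 e)) ?_)
        rw [Nat.sub_eq_zero_of_le h, pow_zero, le_add_iff_nonneg_right]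
        exact mul_nonneg (pow_nonneg hθ0 t) (div_nonneg (hφe e) (by linarith))
    have hsumgg : ∑ e, ∫ ω, gg e ω ∂envLaw ν = ∫ ω, g ω ∂envLaw ν := by
      rw [← integral_finsetSum _ fun e _ => hggi e]
      simp only [gg, ← Finset.mul_sum, sum_foldKernel, mul_one]
    -- At an old site nothing is gained and the exponent stays the same. At a new site the jump law
    -- is independent of `g`, so the surviving directions contribute a factor `ρ` and the exponent
    -- drops by one.
    have hcl1 : (∑ e : Dir d, if e.1 = i then 0 else ∫ ω, gg e ω ∂envLaw ν) *
        ρ ^ (n - S'.card) ≤ (∫ ω, g ω ∂envLaw ν) * ρ ^ (n - S.card) := by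
      by_cases hmem : fold N z ∈ S
      · rw [hS', Finset.insert_eq_of_mem hmem, ← hsumgg]
        gcongr with e
        split
        · exact integral_nonneg (hgg0 e)
        · exact le_rfl
      · have h1 : ∀ e, ∫ ω, gg e ω ∂envLaw ν = (∫ ω, g ω ∂envLaw ν) * ∫ m, m.1 e ∂ν := by
          intro e
          have h2 : IndepFun g (fun ω => foldKernel ω N z e) (envLaw ν) :=
            indepFun_of_dependsOn ν hgm (measurable_foldKernel N z e)
              (Finset.disjoint_singleton_right.2 hmem) hgS
              (by simpa using dependsOn_foldKernel z e)
          rw [← integral_foldKernel (N := N) ν z e]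
          exact h2.integral_mul_eq_mul_integral hgm.aestronglyMeasurable
            (measurable_foldKernel N z e).aestronglyMeasurable
        rw [hS', Finset.card_insert_of_notMem hmem]
        simp only [h1]
        have h2 : (∑ e : Dir d, if e.1 = i then 0 else
            (∫ ω, g ω ∂envLaw ν) * ∫ m, m.1 e ∂ν) ≤ (∫ ω, g ω ∂envLaw ν) * ρ := by
          refine le_trans (le_of_eq ?_) (mul_le_mul_of_nonneg_left hρ (integral_nonneg hg0))
          rw [Finset.mul_sum]
          exact Finset.sum_congr rfl fun e _ => by split <;> simp
        refine (mul_le_mul_of_nonneg_right h2 (pow_nonneg hρ0 _)).trans_eq ?_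
        rw [mul_assoc, ← pow_succ']
        congr 2; omega
    -- The killed directions can be put back, since `φ ≥ 0` at all neighbours of `z`; the full step
    -- then lowers `φ` by `1`.
    have hcl2 : (∑ e : Dir d, if e.1 = i then 0 else (∫ ω, gg e ω ∂envLaw ν) * φ (z + e.vec)) ≤
        (∫ ω, g ω ∂envLaw ν) * (θ * φ z) := by
      calc (∑ e : Dir d, if e.1 = i then 0 else (∫ ω, gg e ω ∂envLaw ν) * φ (z + e.vec))
          ≤ ∑ e : Dir d, (∫ ω, gg e ω ∂envLaw ν) * φ (z + e.vec) := by
            refine Finset.sum_le_sum fun e _ => ?_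
            split
            · exact mul_nonneg (integral_nonneg (hgg0 e)) (hφe e)
            · exact le_rfl
        _ = ∫ ω, ∑ e : Dir d, gg e ω * φ (z + e.vec) ∂envLaw ν := by
            rw [integral_finsetSum _ fun e _ => (hggi e).mul_const _]
            exact Finset.sum_congr rfl fun e _ => (integral_mul_const _ _).symm
        _ = ∫ ω, g ω * (φ z - 1) ∂envLaw ν := by
            refine integral_congr_ae ?_
            filter_upwards [hν] with ω hω
            have hk := hω.isBalancedKernel N
            have h1 := hk.step_sq x z
            simp only [step] at h1
            simp only [gg, mul_assoc, ← Finset.mul_sum, hφ, mul_sub, Finset.sum_sub_distrib, h1]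
            rw [← Finset.sum_mul, hk.sum_eq_one]
            ring
        _ = (∫ ω, g ω ∂envLaw ν) * (φ z - 1) := integral_mul_const _ _
        _ ≤ _ := by
            refine mul_le_mul_of_nonneg_left ?_ (integral_nonneg hg0)
            have h1 : φ z / (2 * c) ≤ 1 := by
              rw [div_le_one (by linarith)]; exact hφle z
            have h2 : θ * φ z = φ z - φ z / (2 * c) := by rw [hθ]; ring
            linarith
    calc ∫ ω, g ω * survival (foldKernel ω N) i (t + 1) z ∂envLaw ν
        = ∫ ω, ∑ e : Dir d, (if e.1 = i then 0 else
            gg e ω * survival (foldKernel ω N) i t (z + e.vec)) ∂envLaw ν := by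
          congr 1; ext ω
          rw [survival_succ, sliceStep, Finset.mul_sum]
          exact Finset.sum_congr rfl fun e _ => by
            split
            · simp
            · simp only [gg]; ring
      _ = ∑ e : Dir d, if e.1 = i then 0 else
            ∫ ω, gg e ω * survival (foldKernel ω N) i t (z + e.vec) ∂envLaw ν := by
          rw [integral_finsetSum _ fun e _ => ?_]
          · exact Finset.sum_congr rfl fun e _ => by split <;> simp
          · split
            · exact integrable_zero _ _ _
            · exact hgq e _
      _ ≤ ∑ e : Dir d, if e.1 = i then 0 else
            (∫ ω, gg e ω ∂envLaw ν) * (ρ ^ (n - S'.card) + θ ^ t * (φ (z + e.vec) / c)) := by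
          refine Finset.sum_le_sum fun e _ => ?_
          split
          · exact le_rfl
          · exact hterm e
      _ = (∑ e : Dir d, if e.1 = i then 0 else ∫ ω, gg e ω ∂envLaw ν) * ρ ^ (n - S'.card) +
          θ ^ t / c * ∑ e : Dir d, if e.1 = i then 0 else
            (∫ ω, gg e ω ∂envLaw ν) * φ (z + e.vec) := by
          rw [Finset.sum_mul, Finset.mul_sum, ← Finset.sum_add_distrib]
          exact Finset.sum_congr rfl fun e _ => by
            split
            · simp
            · ring
      _ ≤ (∫ ω, g ω ∂envLaw ν) * ρ ^ (n - S.card) +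
          θ ^ t / c * ((∫ ω, g ω ∂envLaw ν) * (θ * φ z)) := by
          gcongr
      _ = _ := by ring

lemma exists_pow_le_lt {J : ℕ} (hJ : 0 < J) (t : ℕ) : ∃ n : ℕ, n ^ J ≤ t ∧ t < (n + 1) ^ J := by
  have h : ∃ n, t < (n + 1) ^ J := ⟨t, (Nat.lt_succ_self t).trans_le (Nat.le_self_pow hJ.ne' _)⟩
  classical
  refine ⟨Nat.find h, ?_, Nat.find_spec h⟩
  rcases Nat.eq_zero_or_pos (Nat.find h) with h0 | h0
  · simp [h0, hJ.ne']
  · have := Nat.find_min h (Nat.sub_one_lt h0.ne')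
    rwa [Nat.sub_add_cancel h0, not_lt] at this

lemma exists_pow_mul_pow_le {ρ : ℝ} (h0 : 0 ≤ ρ) (h1 : ρ < 1) (b : ℕ) :
    ∃ C : ℝ, ∀ n : ℕ, ρ ^ n * ((n : ℝ) + 1) ^ b ≤ C := by
  have h := tendsto_pow_const_mul_const_pow_of_abs_lt_one b (r := ρ) (by rwa [abs_of_nonneg h0])
  obtain ⟨C, hC⟩ := h.bddAbove_range
  have hC' : ∀ n : ℕ, (n : ℝ) ^ b * ρ ^ n ≤ C := fun n => hC ⟨n, rfl⟩
  refine ⟨2 ^ b * max C 1, fun n => ?_⟩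
  rcases Nat.eq_zero_or_pos n with rfl | hn
  · have h2 : (1 : ℝ) ≤ 2 ^ b := one_le_pow₀ (by norm_num)
    have h3 : (1 : ℝ) ≤ max C 1 := le_max_right _ _
    simp only [pow_zero, Nat.cast_zero, zero_add, one_pow, mul_one]
    nlinarith
  · have hn' : (1 : ℝ) ≤ n := by exact_mod_cast hn
    calc ρ ^ n * ((n : ℝ) + 1) ^ b ≤ ρ ^ n * (2 * n) ^ b := by gcongr; linarith
      _ = 2 ^ b * ((n : ℝ) ^ b * ρ ^ n) := by rw [mul_pow]; ring
      _ ≤ _ := by gcongr; exact (hC' n).trans (le_max_left _ _)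

lemma ae_eq_zero_of_one_le (ν : Measure (SiteLaw d)) [IsProbabilityMeasure ν] (i : Fin d)
    (h : 1 ≤ ∑ e : Dir d, if e.1 = i then 0 else ∫ m, m.1 e ∂ν) :
    ∀ᵐ m ∂ν, m.1 (i, 1) = 0 := by
  have hi : ∀ e, Integrable (fun m : SiteLaw d => m.1 e) ν := fun e => by
    refine Integrable.of_bound (measurable_siteLaw_apply e).aestronglyMeasurable 1
      (.of_forall fun m => ?_)
    rw [Real.norm_of_nonneg (m.2.1 e), ← m.2.2]
    exact Finset.single_le_sum (fun e _ => m.2.1 e) (Finset.mem_univ e)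
  have h1 : ∑ e : Dir d, ∫ m, m.1 e ∂ν = 1 := by
    rw [← integral_finsetSum _ fun e _ => hi e]
    have : ∀ m : SiteLaw d, ∑ e, m.1 e = 1 := fun m => m.2.2
    simp [this]
  have h0 : ∀ e : Dir d, 0 ≤ ∫ m, m.1 e ∂ν := fun e => integral_nonneg fun m => m.2.1 e
  have h2 : ∫ m, m.1 (i, 1) ∂ν ≤ 0 := by
    have h3 : (∑ e : Dir d, if e.1 = i then 0 else ∫ m, m.1 e ∂ν) +
        (∑ e : Dir d, if e = (i, 1) then ∫ m, m.1 e ∂ν else 0) ≤ ∑ e : Dir d, ∫ m, m.1 e ∂ν := by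
      rw [← Finset.sum_add_distrib]
      refine Finset.sum_le_sum fun e _ => ?_
      by_cases h4 : e = (i, 1)
      · simp [h4]
      · rw [if_neg h4, add_zero]
        split
        · exact h0 e
        · exact le_rfl
    rw [Finset.sum_ite_eq' Finset.univ ((i, 1) : Dir d), if_pos (Finset.mem_univ _)] at h3
    linarith
  have h3 := (integral_eq_zero_iff_of_nonneg (fun m : SiteLaw d => m.2.1 (i, 1))
    (hi (i, 1))).1 (le_antisymm h2 (h0 _))
  filter_upwards [h3] with m hm using hm

/-- Otherwise `ν`-almost every site law would give no mass to `+e_i`, so almost surely no site of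
the environment would allow that step. -/
lemma sum_integral_lt_one (ν : Measure (SiteLaw d)) [IsProbabilityMeasure ν]
    (hν : ∀ᵐ ω ∂envLaw ν, GenuinelyDDimensional ω) (i : Fin d) :
    (∑ e : Dir d, if e.1 = i then 0 else ∫ m, m.1 e ∂ν) < 1 := by
  by_contra! h
  have h1 := ae_eq_zero_of_one_le ν i h
  have h2 : ∀ᵐ ω ∂envLaw ν, ∀ z, jump ω z (i, 1) = 0 := by
    rw [ae_all_iff]
    intro z
    exact (measurePreserving_eval_infinitePi (fun _ : Fin d → ℤ => ν) z).quasiMeasurePreserving.ae h1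
  obtain ⟨ω, h3, h4⟩ := (hν.and h2).exists
  obtain ⟨z, hz⟩ := h3 (i, 1)
  exact hz.ne' (h4 z)

lemma integral_survival_le_one (ν : Measure (SiteLaw d)) [IsProbabilityMeasure ν]
    (hν : ∀ᵐ ω ∂envLaw ν, Balanced ω) (N : ℕ) (i : Fin d) (t : ℕ) (x : Fin d → ℤ) :
    ∫ ω, survival (foldKernel ω N) i t x ∂envLaw ν ≤ 1 := by
  calc ∫ ω, survival (foldKernel ω N) i t x ∂envLaw ν ≤ ∫ _, (1 : ℝ) ∂envLaw ν := by
        refine integral_mono_ae (integrable_of_unit ν (C := 1) (measurable_survival N i t x) ?_ ?_)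
          (integrable_const _) ?_
        · filter_upwards [hν] with ω hω using survival_nonneg (hω.isBalancedKernel N) t x
        all_goals
          filter_upwards [hν] with ω hω using survival_le_one (hω.isBalancedKernel N) t x
    _ = 1 := by simp

/-- The annealed survival probability decays faster than any polynomial. -/
lemma exists_integral_survival_le (ν : Measure (SiteLaw d)) [IsProbabilityMeasure ν]
    (hν : ∀ᵐ ω ∂envLaw ν, Balanced ω ∧ GenuinelyDDimensional ω) (hd : 0 < d) (b : ℕ) :
    ∃ C : ℝ, 0 ≤ C ∧ ∀ (i : Fin d) (N t : ℕ) (x : Fin d → ℤ), 0 < N → t ≤ N →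
      ∫ ω, survival (foldKernel ω N) i t x ∂envLaw ν ≤ C / (1 + t) ^ b := by
  have hbal : ∀ᵐ ω ∂envLaw ν, Balanced ω := hν.mono fun _ h => h.1
  have hd' : (0 : ℝ) < d := by exact_mod_cast hd
  suffices h : ∀ i : Fin d, ∃ C : ℝ, 0 ≤ C ∧ ∀ (N t : ℕ) (x : Fin d → ℤ), 0 < N → t ≤ N →
      ∫ ω, survival (foldKernel ω N) i t x ∂envLaw ν ≤ C / (1 + t) ^ b by
    choose C hC0 hC using h
    refine ⟨∑ i, C i, Finset.sum_nonneg fun i _ => hC0 i, fun i N t x hN ht => ?_⟩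
    refine (hC i N t x hN ht).trans ?_
    gcongr
    exact Finset.single_le_sum (fun i _ => hC0 i) (Finset.mem_univ i)
  intro i
  set ρ₀ := ∑ e : Dir d, if e.1 = i then 0 else ∫ m, m.1 e ∂ν with hρ₀
  have hρ₀1 : ρ₀ < 1 := sum_integral_lt_one ν (hν.mono fun _ h => h.2) i
  have hρ₀0 : 0 ≤ ρ₀ := Finset.sum_nonneg fun e _ => by
    split
    · exact le_rfl
    · exact integral_nonneg fun m => m.2.1 e
  -- One rate for both terms of the estimate: `ρ₀ ^ n` for `n` new sites, and `exp (-n / (8 d))` for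
  -- confinement up to a time `t ≥ n ^ 3`.
  set ρ := max ρ₀ (Real.exp (-(1 / (8 * d)))) with hρ
  have hρ1 : ρ < 1 := max_lt hρ₀1 (by
    rw [← Real.exp_zero]
    exact Real.exp_lt_exp.2 (by rw [neg_lt_zero]; positivity))
  have hρ0 : 0 ≤ ρ := hρ₀0.trans (le_max_left _ _)
  obtain ⟨C, hC⟩ := exists_pow_mul_pow_le hρ0 hρ1 (3 * b)
  have hC0 : 0 ≤ C := le_trans (by positivity) (hC 0)
  refine ⟨max (9 ^ b) (3 * C), by positivity, fun N t x hN ht => ?_⟩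
  have hT : (0 : ℝ) < (1 + t) ^ b := by positivity
  -- For `t ≥ 8` the integer cube root `n` is at least `2`, so that `2n ≤ n ^ 3 ≤ t ≤ N`. Small
  -- times are absorbed in the constant `9 ^ b`.
  rcases lt_or_ge t 8 with ht8 | ht8
  · refine (integral_survival_le_one ν hbal N i t x).trans ?_
    rw [one_le_div hT]
    refine le_trans ?_ (le_max_left _ _)
    gcongr
    have : (t : ℝ) < 8 := by exact_mod_cast ht8
    linarith
  obtain ⟨n, hn1, hn2⟩ := exists_pow_le_lt (J := 3) (by norm_num) t
  have hn : 2 ≤ n := by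
    by_contra! h
    have : n + 1 ≤ 2 := by omega
    have := Nat.pow_le_pow_left this 3
    omega
  have hnN : 2 * n ≤ N := by nlinarith
  have hn0 : (0 : ℝ) < n := by exact_mod_cast (by omega : 0 < n)
  have key := integral_mul_survival_le ν hbal hd hN i (n := n) (by omega) hnN x hρ₀0 le_rfl t ∅ x
    (fun _ => 1) (crosses_self x) (by simp; omega) measurable_const (fun _ => zero_le_one)
    (fun _ => le_rfl) (by simpa using dependsOn_const (1 : ℝ))
  simp only [one_mul, integral_const, probReal_univ, smul_eq_mul, Finset.card_empty, Nat.sub_zero,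
    sub_self, ne_eq, OfNat.ofNat_ne_zero, not_false_eq_true, zero_pow, Finset.sum_const_zero,
    sub_zero] at key
  have h2 : (8 : ℝ) * d * n ^ 2 / (4 * d * n ^ 2) = 2 := by field_simp; norm_num
  rw [h2] at key
  have h3 : (1 - 1 / (8 * d * (n : ℝ) ^ 2)) ^ t ≤ ρ ^ n := by
    have h4 : 1 - 1 / (8 * d * (n : ℝ) ^ 2) ≤ Real.exp (-(1 / (8 * d * (n : ℝ) ^ 2))) := by
      have := Real.add_one_le_exp (-(1 / (8 * d * (n : ℝ) ^ 2)))
      linarith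
    have h5 : 0 ≤ 1 - 1 / (8 * d * (n : ℝ) ^ 2) := by
      rw [sub_nonneg, div_le_one (by positivity)]
      have h6 : (1 : ℝ) ≤ d := by exact_mod_cast hd
      have h7 : (1 : ℝ) ≤ n ^ 2 := by
        have : (1 : ℝ) ≤ n := by exact_mod_cast (by omega : 1 ≤ n)
        exact one_le_pow₀ this
      nlinarith
    have hn1' : (n : ℝ) ^ 3 ≤ t := by exact_mod_cast hn1
    calc (1 - 1 / (8 * d * (n : ℝ) ^ 2)) ^ t
        ≤ Real.exp (-(1 / (8 * d * (n : ℝ) ^ 2))) ^ t := pow_le_pow_left₀ h5 h4 t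
      _ = Real.exp (-(t / (8 * d * (n : ℝ) ^ 2))) := by rw [← Real.exp_nat_mul]; congr 1; ring
      _ ≤ Real.exp (-(n / (8 * d))) := by
          rw [Real.exp_le_exp, neg_le_neg_iff, div_le_div_iff₀ (by positivity) (by positivity)]
          nlinarith
      _ = Real.exp (-(1 / (8 * d))) ^ n := by rw [← Real.exp_nat_mul]; congr 1; ring
      _ ≤ ρ ^ n := pow_le_pow_left₀ (Real.exp_pos _).le (le_max_right _ _) n
  have h4 : ρ₀ ^ n ≤ ρ ^ n := pow_le_pow_left₀ hρ₀0 (le_max_left _ _) n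
  rw [le_div_iff₀ hT]
  refine le_trans ?_ (le_max_right _ _)
  have h5 : (1 + (t : ℝ)) ^ b ≤ ((n : ℝ) + 1) ^ (3 * b) := by
    rw [pow_mul]
    have : 1 + (t : ℝ) ≤ ((n : ℝ) + 1) ^ 3 := by
      exact_mod_cast (by omega : 1 + t ≤ (n + 1) ^ 3)
    gcongr
  calc (∫ ω, survival (foldKernel ω N) i t x ∂envLaw ν) * (1 + (t : ℝ)) ^ b
      ≤ (3 * ρ ^ n) * ((n : ℝ) + 1) ^ (3 * b) := by
        gcongr
        linarith
    _ = 3 * (ρ ^ n * ((n : ℝ) + 1) ^ (3 * b)) := by ring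
    _ ≤ 3 * C := by gcongr; exact hC n

/-! ### ### From annealed to almost sure bounds -/

/-- Chebyshev's inequality for sums of bounded random variables with few dependent pairs. -/
lemma measureReal_sum_ge_le (ν : Measure (SiteLaw d)) [IsProbabilityMeasure ν]
    {A : Finset (Fin d → ℤ)} {Z : (Fin d → ℤ) → Env d → ℝ} {m : ℝ}
    (hZm : ∀ x, Measurable (Z x)) (hZ0 : ∀ᵐ ω ∂envLaw ν, ∀ x, 0 ≤ Z x ω)
    (hZ1 : ∀ᵐ ω ∂envLaw ν, ∀ x, Z x ω ≤ m) (nbr : (Fin d → ℤ) → Finset (Fin d → ℤ)) {D : ℕ}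
    (hcard : ∀ x, (nbr x).card ≤ D)
    (hind : ∀ x ∈ A, ∀ y ∈ A, y ∉ nbr x → IndepFun (Z x) (Z y) (envLaw ν))
    {T : ℝ} (hT : 0 < T) :
    (envLaw ν).real {ω | ∑ x ∈ A, (∫ ω, Z x ω ∂envLaw ν) + T ≤ ∑ x ∈ A, Z x ω} ≤
      A.card * D * m ^ 2 / T ^ 2 := by
  classical
  have hL : ∀ x, MemLp (Z x) 2 (envLaw ν) := fun x => by
    refine MemLp.of_bound (hZm x).aestronglyMeasurable m ?_
    filter_upwards [hZ0, hZ1] with ω h0 h1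
    rw [Real.norm_of_nonneg (h0 x)]; exact h1 x
  have hI : ∀ x, Integrable (Z x) (envLaw ν) := fun x => (hL x).integrable (by norm_num)
  have hLs : MemLp (∑ x ∈ A, Z x) 2 (envLaw ν) := memLp_finsetSum' _ fun x _ => hL x
  have hcov : ∀ x y, cov[Z x, Z y; envLaw ν] ≤ m ^ 2 := by
    intro x y
    rw [covariance_eq_sub (hL x) (hL y)]
    have h1 : ∫ ω, (Z x * Z y) ω ∂envLaw ν ≤ ∫ _, m ^ 2 ∂envLaw ν := by
      refine integral_mono_ae ((hL x).integrable_mul (hL y)) (integrable_const _) ?_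
      filter_upwards [hZ0, hZ1] with ω h0 h1
      rw [sq]
      exact mul_le_mul (h1 x) (h1 y) (h0 y) ((h0 x).trans (h1 x))
    have h2 : 0 ≤ ∫ ω, Z x ω ∂envLaw ν :=
      integral_nonneg_of_ae (hZ0.mono fun ω h => h x)
    have h3 : 0 ≤ ∫ ω, Z y ω ∂envLaw ν :=
      integral_nonneg_of_ae (hZ0.mono fun ω h => h y)
    simp only [integral_const, probReal_univ, one_smul] at h1
    have := mul_nonneg h2 h3
    linarith
  -- Only pairs with `y ∈ nbr x` contribute to the variance, at most `D` for each `x`, and each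
  -- covariance is at most `m ^ 2`.
  have hvar : Var[∑ x ∈ A, Z x; envLaw ν] ≤ A.card * D * m ^ 2 := by
    rw [variance_sum' fun x _ => hL x, mul_assoc, ← nsmul_eq_mul]
    refine Finset.sum_le_card_nsmul _ _ _ fun x hx => ?_
    calc ∑ y ∈ A, cov[Z x, Z y; envLaw ν] ≤ ∑ y ∈ A, if y ∈ nbr x then m ^ 2 else 0 := by
          refine Finset.sum_le_sum fun y hy => ?_
          split
          · exact hcov x y
          · next h => exact ((hind x hx y hy h).covariance_eq_zero (hL x) (hL y)).le
      _ = ((A.filter (· ∈ nbr x)).card : ℝ) * m ^ 2 := by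
          rw [← Finset.sum_filter, Finset.sum_const, nsmul_eq_mul]
      _ ≤ D * m ^ 2 := by
          gcongr
          refine le_trans (Finset.card_le_card fun y hy => ?_) (hcard x)
          exact (Finset.mem_filter.1 hy).2
  have hch := meas_ge_le_variance_div_sq hLs hT
  have hsum : ∫ ω, (∑ x ∈ A, Z x) ω ∂envLaw ν = ∑ x ∈ A, ∫ ω, Z x ω ∂envLaw ν := by
    simp only [Finset.sum_apply]
    exact integral_finsetSum _ fun x _ => hI x
  rw [hsum] at hch
  have hsub : {ω | ∑ x ∈ A, (∫ ω, Z x ω ∂envLaw ν) + T ≤ ∑ x ∈ A, Z x ω} ⊆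
      {ω | T ≤ |(∑ x ∈ A, Z x) ω - ∑ x ∈ A, ∫ ω, Z x ω ∂envLaw ν|} := by
    intro ω hω
    simp only [Set.mem_ofPred_eq, Finset.sum_apply] at hω ⊢
    exact le_trans (by linarith) (le_abs_self _)
  have h1 : (envLaw ν).real {ω | ∑ x ∈ A, (∫ ω, Z x ω ∂envLaw ν) + T ≤ ∑ x ∈ A, Z x ω} ≤
      Var[∑ x ∈ A, Z x; envLaw ν] / T ^ 2 := by
    refine ENNReal.toReal_le_of_le_ofReal (div_nonneg (variance_nonneg _ _) (sq_nonneg _)) ?_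
    exact (measure_mono hsub).trans hch
  refine h1.trans ?_
  gcongr

/-- A version of the Borel–Cantelli lemma. -/
lemma ae_eventually_of_measureReal_le {Ω : Type*} [MeasurableSpace Ω] (μ : Measure Ω)
    [IsProbabilityMeasure μ] {p : ℕ → Ω → Prop} {K : ℝ}
    (h : ∀ N : ℕ, 0 < N → μ.real {ω | ¬ p N ω} ≤ K / (N : ℝ) ^ (3 / 2 : ℝ)) :
    ∀ᵐ ω ∂μ, ∀ᶠ N in Filter.atTop, p N ω := by
  have hs : Summable fun N : ℕ => K / ((N + 1 : ℕ) : ℝ) ^ (3 / 2 : ℝ) := by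
    have h1 := (Real.summable_one_div_nat_rpow (p := 3 / 2)).2 (by norm_num)
    have h2 := ((summable_nat_add_iff 1).2 h1).mul_left K
    refine h2.congr fun N => ?_
    rw [mul_one_div]
  have h3 : ∑' N : ℕ, μ {ω | ¬ p (N + 1) ω} ≠ ⊤ := by
    refine ne_top_of_le_ne_top hs.tsum_ofReal_ne_top (ENNReal.tsum_le_tsum fun N => ?_)
    rw [← ENNReal.ofReal_toReal (measure_ne_top μ _)]
    exact ENNReal.ofReal_le_ofReal (h (N + 1) N.succ_pos)
  filter_upwards [ae_eventually_notMem h3] with ω hω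
  obtain ⟨n, hn⟩ := Filter.eventually_atTop.1 hω
  refine Filter.eventually_atTop.2 ⟨n + 1, fun N hN => ?_⟩
  obtain ⟨N, rfl⟩ : ∃ M, N = M + 1 := ⟨N - 1, by omega⟩
  have := hn N (by omega)
  simpa using this

lemma disjoint_image_fold_box (hN : 0 < N) {k : ℕ} {x y : Fin d → ℤ}
    (hx : x ∈ cube d N) (hy : y ∈ cube d N) (hxy : y ∉ box x (2 * k)) :
    Disjoint ((box x k).image (fold N)) ((box y k).image (fold N)) := by
  rw [Finset.disjoint_left]
  intro w hw hw'
  obtain ⟨v, hv, rfl⟩ := Finset.mem_image.1 hw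
  obtain ⟨v', hv', h⟩ := Finset.mem_image.1 hw'
  refine hxy (mem_box.2 fun j => ?_)
  have h1 := (fold₁_dist_le hN (mem_cube.1 hx j).1 (mem_cube.1 hx j).2 (v j)).trans (mem_box.1 hv j)
  have h2 := (fold₁_dist_le hN (mem_cube.1 hy j).1 (mem_cube.1 hy j).2 (v' j)).trans
    (mem_box.1 hv' j)
  have h3 : fold₁ N (v' j) = fold₁ N (v j) := congrFun h j
  rw [h3] at h2
  rw [abs_le] at *
  push_cast
  constructor <;> linarith [h1.1, h1.2, h2.1, h2.2]

/-- The time-weighted sum of the survival probabilities up to time `k`. -/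
def weightedSurvival (N c k : ℕ) (i : Fin d) (x : Fin d → ℤ) (ω : Env d) : ℝ :=
  ∑ t ∈ Finset.range k, (1 + (t : ℝ)) ^ c * survival (foldKernel ω N) i t x

lemma measurable_weightedSurvival (N c k : ℕ) (i : Fin d) (x : Fin d → ℤ) :
    Measurable (weightedSurvival N c k i x) :=
  Finset.measurable_sum _ fun t _ => (measurable_survival N i t x).const_mul _

lemma dependsOn_weightedSurvival (N c k : ℕ) (i : Fin d) (x : Fin d → ℤ) : DependsOn (weightedSurvival N c k i x)
      ((box x k).image (fold N) : Finset (Fin d → ℤ)) := by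
  classical
  intro ω ω' h
  refine Finset.sum_congr rfl fun t ht => ?_
  congr 1
  refine dependsOn_survival N i t x fun y hy => h y ?_
  obtain ⟨w, hw, rfl⟩ := Finset.mem_image.1 (Finset.mem_coe.1 hy)
  refine Finset.mem_coe.2 (Finset.mem_image_of_mem _ (mem_box.2 fun j => ?_))
  refine (mem_box.1 hw j).trans ?_
  exact_mod_cast (Finset.mem_range.1 ht).le

lemma weightedSurvival_le {ω : Env d} (hω : Balanced ω) (N c k : ℕ) (i : Fin d) (x : Fin d → ℤ) :
    weightedSurvival N c k i x ω ≤ (k : ℝ) ^ (c + 1) := by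
  have ha := hω.isBalancedKernel N
  calc weightedSurvival N c k i x ω ≤ ∑ _t ∈ Finset.range k, (k : ℝ) ^ c := by
        refine Finset.sum_le_sum fun t ht => ?_
        refine (mul_le_of_le_one_right (by positivity) (survival_le_one ha t x)).trans ?_
        have : 1 + (t : ℝ) ≤ k := by
          have := Finset.mem_range.1 ht
          exact_mod_cast (by omega : 1 + t ≤ k)
        gcongr
    _ = _ := by rw [Finset.sum_const, Finset.card_range, nsmul_eq_mul, pow_succ']

lemma weightedSurvival_nonneg {ω : Env d} (hω : Balanced ω) (N c k : ℕ) (i : Fin d)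
    (x : Fin d → ℤ) : 0 ≤ weightedSurvival N c k i x ω :=
  Finset.sum_nonneg fun t _ =>
    mul_nonneg (by positivity) (survival_nonneg (hω.isBalancedKernel N) t x)

lemma integrable_survival (ν : Measure (SiteLaw d)) [IsProbabilityMeasure ν]
    (hν : ∀ᵐ ω ∂envLaw ν, Balanced ω) (N : ℕ) (i : Fin d) (t : ℕ) (x : Fin d → ℤ) :
    Integrable (fun ω => survival (foldKernel ω N) i t x) (envLaw ν) := by
  refine integrable_of_unit ν (C := 1) (measurable_survival N i t x) ?_ ?_
  · filter_upwards [hν] with ω hω using survival_nonneg (hω.isBalancedKernel N) t x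
  · filter_upwards [hν] with ω hω using survival_le_one (hω.isBalancedKernel N) t x

lemma integral_weightedSurvival_le (ν : Measure (SiteLaw d)) [IsProbabilityMeasure ν]
    (hν : ∀ᵐ ω ∂envLaw ν, Balanced ω) {c k : ℕ} {i : Fin d} {x : Fin d → ℤ} {C : ℝ} (hC : 0 ≤ C)
    (h : ∀ t < k, ∫ ω, survival (foldKernel ω N) i t x ∂envLaw ν ≤ C / (1 + t) ^ (c + 2)) :
    ∫ ω, weightedSurvival N c k i x ω ∂envLaw ν ≤ 2 * C := by
  simp only [weightedSurvival]
  rw [integral_finsetSum _ fun t _ => (integrable_survival ν hν N i t x).const_mul _]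
  calc ∑ t ∈ Finset.range k, ∫ ω, (1 + (t : ℝ)) ^ c * survival (foldKernel ω N) i t x ∂envLaw ν
      ≤ ∑ t ∈ Finset.range k, 2 * C * (1 / (((t : ℝ) + 1) * (t + 2))) := by
        refine Finset.sum_le_sum fun t ht => ?_
        rw [integral_const_mul]
        calc (1 + (t : ℝ)) ^ c * ∫ ω, survival (foldKernel ω N) i t x ∂envLaw ν
            ≤ (1 + (t : ℝ)) ^ c * (C / (1 + t) ^ (c + 2)) := by
              gcongr; exact h t (Finset.mem_range.1 ht)
          _ = C * (1 / (1 + (t : ℝ)) ^ 2) := by rw [pow_add]; field_simp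
          _ ≤ C * (2 * (1 / (((t : ℝ) + 1) * (t + 2)))) := by
              gcongr
              rw [mul_one_div, div_le_div_iff₀ (by positivity) (by positivity)]
              nlinarith
          _ = _ := by ring
    _ = 2 * C * (1 - 1 / ((k : ℝ) + 1)) := by rw [← Finset.mul_sum, sum_range_weight]
    _ ≤ 2 * C := by
        have h1 : 0 ≤ 1 / ((k : ℝ) + 1) := by positivity
        have h2 := mul_nonneg (by positivity : 0 ≤ 2 * C) h1
        linarith

/-- The summands have dependence range `2k` and size at most `k^(c+1)`, so Chebyshev with deviation
`N^d` gives at most `5^d * k^(d+2c+2) / N^d`. The assumption on `k` makes the power of `k` at most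
`N^(1/2)`, and `d ≥ 2` leaves the summable rate `N^(-3/2)`. -/
lemma measureReal_weightedSurvival_le (ν : Measure (SiteLaw d)) [IsProbabilityMeasure ν]
    (hν : ∀ᵐ ω ∂envLaw ν, Balanced ω) (hd : 2 ≤ d) (hN : 0 < N) {c k : ℕ} (hk0 : 0 < k)
    (hkN : k ^ (2 * (d + 2 * c + 2)) ≤ N) {i : Fin d} {C : ℝ} (hC : 0 ≤ C)
    (h : ∀ x, ∀ t < k, ∫ ω, survival (foldKernel ω N) i t x ∂envLaw ν ≤ C / (1 + t) ^ (c + 2)) :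
    (envLaw ν).real {ω | (2 * C + 1) * (N : ℝ) ^ d ≤
      ∑ x ∈ cube d N, weightedSurvival N c k i x ω} ≤ 5 ^ d / (N : ℝ) ^ (3 / 2 : ℝ) := by
  classical
  have hNr : (1 : ℝ) ≤ N := by exact_mod_cast hN
  have hN0 : (0 : ℝ) < N := by linarith
  have hNN : (0 : ℝ) < (N : ℝ) ^ d := by positivity
  have hk1 : (1 : ℝ) ≤ k := by exact_mod_cast hk0
  have h1 := measureReal_sum_ge_le ν (A := cube d N) (Z := weightedSurvival N c k i)
    (m := (k : ℝ) ^ (c + 1)) (measurable_weightedSurvival N c k i)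
    (hν.mono fun ω hω x => weightedSurvival_nonneg hω N c k i x)
    (hν.mono fun ω hω x => weightedSurvival_le hω N c k i x) (fun x => box x (2 * k))
    (D := (2 * (2 * k) + 1) ^ d) (fun x => (card_box x _).le)
    (fun x hx y hy hxy => indepFun_of_dependsOn ν (measurable_weightedSurvival N c k i x)
      (measurable_weightedSurvival N c k i y) (disjoint_image_fold_box hN hx hy hxy)
      (dependsOn_weightedSurvival N c k i x) (dependsOn_weightedSurvival N c k i y)) hNN
  have h2 : ∑ x ∈ cube d N, ∫ ω, weightedSurvival N c k i x ω ∂envLaw ν ≤ 2 * C * (N : ℝ) ^ d := by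
    calc ∑ x ∈ cube d N, ∫ ω, weightedSurvival N c k i x ω ∂envLaw ν
        ≤ ∑ _x ∈ cube d N, 2 * C := Finset.sum_le_sum fun x _ =>
          integral_weightedSurvival_le ν hν hC (h x)
      _ = _ := by rw [Finset.sum_const, nsmul_eq_mul, card_cube]; ring
  have h3 : (envLaw ν).real {ω | (2 * C + 1) * (N : ℝ) ^ d ≤
      ∑ x ∈ cube d N, weightedSurvival N c k i x ω} ≤
      (envLaw ν).real {ω | ∑ x ∈ cube d N, (∫ ω, weightedSurvival N c k i x ω ∂envLaw ν) +
        (N : ℝ) ^ d ≤ ∑ x ∈ cube d N, weightedSurvival N c k i x ω} := by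
    refine measureReal_mono (fun ω hω => ?_)
    simp only [Set.mem_ofPred_eq] at hω ⊢
    linarith
  refine h3.trans (h1.trans ?_)
  rw [card_cube]
  have h4 : (k : ℝ) ^ (d + 2 * c + 2) ≤ (N : ℝ) ^ (1 / 2 : ℝ) := by
    rw [← Real.sqrt_eq_rpow]
    refine Real.le_sqrt_of_sq_le ?_
    rw [← pow_mul, mul_comm]
    exact_mod_cast hkN
  have h5 : (N : ℝ) ^ (2 : ℕ) ≤ (N : ℝ) ^ d := pow_le_pow_right₀ hNr hd
  have h6 : (N : ℝ) ^ (1 / 2 : ℝ) * (N : ℝ) ^ (3 / 2 : ℝ) = (N : ℝ) ^ (2 : ℕ) := by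
    rw [← Real.rpow_add hN0, ← Real.rpow_natCast]; norm_num
  have h7 : (((2 * (2 * k) + 1) ^ d : ℕ) : ℝ) ≤ (5 * (k : ℝ)) ^ d := by
    push_cast
    gcongr
    linarith
  rw [div_le_div_iff₀ (by positivity) (by positivity)]
  calc (N : ℝ) ^ d * (((2 * (2 * k) + 1) ^ d : ℕ) : ℝ) * ((k : ℝ) ^ (c + 1)) ^ 2 *
        (N : ℝ) ^ (3 / 2 : ℝ)
      ≤ (N : ℝ) ^ d * (5 * (k : ℝ)) ^ d * ((k : ℝ) ^ (c + 1)) ^ 2 * (N : ℝ) ^ (3 / 2 : ℝ) := by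
        gcongr
    _ = (N : ℝ) ^ d * 5 ^ d * ((k : ℝ) ^ (d + 2 * c + 2) * (N : ℝ) ^ (3 / 2 : ℝ)) := by
        rw [mul_pow]; ring
    _ ≤ (N : ℝ) ^ d * 5 ^ d * ((N : ℝ) ^ (1 / 2 : ℝ) * (N : ℝ) ^ (3 / 2 : ℝ)) := by gcongr
    _ ≤ (N : ℝ) ^ d * 5 ^ d * (N : ℝ) ^ d := by rw [h6]; gcongr
    _ = _ := by ring

/-- Markov's inequality at each point and a union bound over the `N^d` points: since `N < (k+1)^J`,
annealed decay of order `J (d + 2)` in `k` beats the number of points by `N^2`. -/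
lemma measureReal_exists_survival_gt_le (ν : Measure (SiteLaw d)) [IsProbabilityMeasure ν]
    (hν : ∀ᵐ ω ∂envLaw ν, Balanced ω) (hN : 0 < N) {k J : ℕ} (hk : N < (k + 1) ^ J) {i : Fin d}
    {C : ℝ} (hC : 0 ≤ C)
    (h : ∀ x, ∫ ω, survival (foldKernel ω N) i k x ∂envLaw ν ≤ C / (1 + k) ^ (J * (d + 2))) :
    (envLaw ν).real {ω | ¬ ∀ x ∈ cube d N, survival (foldKernel ω N) i k x ≤ 1 / 2} ≤
      2 * C / (N : ℝ) ^ (3 / 2 : ℝ) := by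
  have hNr : (1 : ℝ) ≤ N := by exact_mod_cast hN
  have hN0 : (0 : ℝ) < N := by linarith
  have h1 : {ω : Env d | ¬ ∀ x ∈ cube d N, survival (foldKernel ω N) i k x ≤ 1 / 2} ⊆
      ⋃ x ∈ cube d N, {ω | 1 / 2 ≤ survival (foldKernel ω N) i k x} := by
    intro ω hω
    simp only [Set.mem_ofPred_eq, not_forall, not_le] at hω
    obtain ⟨x, hx, h2⟩ := hω
    exact Set.mem_iUnion₂.2 ⟨x, hx, h2.le⟩
  have h2 : ∀ x, (envLaw ν).real {ω | 1 / 2 ≤ survival (foldKernel ω N) i k x} ≤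
      2 * C / (N : ℝ) ^ (d + 2) := by
    intro x
    have h3 := mul_meas_ge_le_integral_of_nonneg
      (hν.mono fun ω hω => survival_nonneg (hω.isBalancedKernel N) k x)
      (integrable_survival ν hν N i k x) (1 / 2)
    have h4 : C / (1 + (k : ℝ)) ^ (J * (d + 2)) ≤ C / (N : ℝ) ^ (d + 2) := by
      have h5 : (N : ℝ) ≤ (1 + (k : ℝ)) ^ J := by
        rw [add_comm]; exact_mod_cast hk.le
      rw [pow_mul]
      gcongr
    have h5 := h3.trans ((h x).trans h4)
    rw [mul_div_assoc]
    linarith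
  calc (envLaw ν).real {ω | ¬ ∀ x ∈ cube d N, survival (foldKernel ω N) i k x ≤ 1 / 2}
      ≤ (envLaw ν).real (⋃ x ∈ cube d N, {ω | 1 / 2 ≤ survival (foldKernel ω N) i k x}) :=
        measureReal_mono h1 (measure_ne_top _ _)
    _ ≤ ∑ x ∈ cube d N, (envLaw ν).real {ω | 1 / 2 ≤ survival (foldKernel ω N) i k x} :=
        measureReal_biUnion_finset_le _ _
    _ ≤ ∑ _x ∈ cube d N, 2 * C / (N : ℝ) ^ (d + 2) := Finset.sum_le_sum fun x _ => h2 x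
    _ = 2 * C / (N : ℝ) ^ (2 : ℝ) := by
        rw [Finset.sum_const, nsmul_eq_mul, card_cube, pow_add,
          show (2 : ℝ) = (2 : ℕ) by norm_num, Real.rpow_natCast]
        field_simp
    _ ≤ _ := by
        gcongr
        norm_num

/-- Almost surely, the survival probabilities are eventually well behaved in all large cubes. -/
lemma exists_ae_eventually_survival_le (ν : Measure (SiteLaw d)) [IsProbabilityMeasure ν]
    (hν : ∀ᵐ ω ∂envLaw ν, Balanced ω ∧ GenuinelyDDimensional ω) (hd : 2 ≤ d) (c : ℕ) :
    ∃ C₀ : ℝ, 0 ≤ C₀ ∧ ∀ᵐ ω ∂envLaw ν, ∀ᶠ N : ℕ in Filter.atTop, ∃ k ≤ N,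
      (∀ i, ∀ x ∈ cube d N, survival (foldKernel ω N) i k x ≤ 1 / 2) ∧
      ∀ i, ∀ t < k, ∑ x ∈ cube d N, survival (foldKernel ω N) i t x ≤
        C₀ * N ^ d / (1 + t) ^ c := by
  have hbal : ∀ᵐ ω ∂envLaw ν, Balanced ω := hν.mono fun _ h => h.1
  -- The horizon `k` is the integer `J`-th root of `N`: short enough for the variance bound, yet
  -- long enough for survival up to time `k` to be negligible at all points of the cube at once.
  set J := 2 * (d + 2 * c + 2) with hJ
  have hJ0 : 0 < J := by omega
  choose k hk1 hk2 using fun N => exists_pow_le_lt hJ0 N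
  have hkN : ∀ N, k N ≤ N := fun N => (Nat.le_self_pow hJ0.ne' _).trans (hk1 N)
  have hk0 : ∀ N, 0 < N → 0 < k N := fun N hN => by
    by_contra! h
    have := hk2 N
    rw [Nat.le_zero.1 h] at this
    simp at this
    omega
  obtain ⟨C, hC0, hC⟩ := exists_integral_survival_le ν hν (by omega) (c + 2)
  obtain ⟨C', hC0', hC'⟩ := exists_integral_survival_le ν hν (by omega) (J * (d + 2))
  refine ⟨2 * C + 1, by positivity, ?_⟩
  have hA : ∀ᵐ ω ∂envLaw ν, ∀ i, ∀ᶠ N : ℕ in Filter.atTop,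
      ∀ x ∈ cube d N, survival (foldKernel ω N) i (k N) x ≤ 1 / 2 := by
    rw [ae_all_iff]
    intro i
    exact ae_eventually_of_measureReal_le (envLaw ν) (K := 2 * C') fun N hN =>
      measureReal_exists_survival_gt_le ν hbal hN (hk2 N) hC0' fun x => hC' i N _ x hN (hkN N)
  have hB : ∀ᵐ ω ∂envLaw ν, ∀ i, ∀ᶠ N : ℕ in Filter.atTop,
      ∑ x ∈ cube d N, weightedSurvival N c (k N) i x ω < (2 * C + 1) * (N : ℝ) ^ d := by
    rw [ae_all_iff]
    intro i
    refine ae_eventually_of_measureReal_le (envLaw ν) (K := 5 ^ d) fun N hN => ?_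
    simp only [not_lt]
    exact measureReal_weightedSurvival_le ν hbal hd hN (hk0 N hN) (hk1 N) hC0 fun x t ht =>
      hC i N t x hN (ht.le.trans (hkN N))
  filter_upwards [hbal, hA, hB] with ω hω h1 h2
  filter_upwards [Filter.eventually_all.2 h1, Filter.eventually_all.2 h2] with N h3 h4
  refine ⟨k N, hkN N, h3, fun i t ht => ?_⟩
  -- One weighted sum controls all times `t < k` simultaneously, since each of its terms is
  -- nonnegative.
  rw [le_div_iff₀ (by positivity), Finset.sum_mul]
  refine le_trans (Finset.sum_le_sum fun x _ => ?_) (h4 i).le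
  rw [mul_comm]
  exact Finset.single_le_sum
    (f := fun t : ℕ => (1 + (t : ℝ)) ^ c * survival (foldKernel ω N) i t x)
    (fun t _ => mul_nonneg (by positivity) (survival_nonneg (hω.isBalancedKernel N) t x))
    (Finset.mem_range.2 ht)

/-! ### ### Bounds on the density and the support -/

lemma exists_ae_eventually_cubeNorm_lt (hd : 2 ≤ d) (ν : Measure (SiteLaw d))
    [IsProbabilityMeasure ν]
    (hν : ∀ᵐ ω ∂envLaw ν, Balanced ω ∧ GenuinelyDDimensional ω) {p' : ℝ} (h1 : 1 < p')
    (hp : p' < (d : ℝ) / ((d : ℝ) - 1)) :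
    ∃ C : ℝ, ∀ᵐ ω ∂envLaw ν, ∀ᶠ N : ℕ in Filter.atTop, ∀ Q : (Fin d → ℤ) → ℝ,
      IsStationary ω N Q → cubeNorm N p' (density N Q) < C := by
  obtain ⟨c, hc⟩ := exists_cubeNorm_density_lt hd h1 hp
  obtain ⟨C₀, hC₀, hev⟩ := exists_ae_eventually_survival_le ν hν hd c
  obtain ⟨C, hC⟩ := hc C₀ hC₀
  refine ⟨C, ?_⟩
  filter_upwards [hν, hev] with ω hω h
  filter_upwards [h, Filter.eventually_gt_atTop 0] with N hN hN0 Q hQ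
  obtain ⟨k, hk, h2, h3⟩ := hN
  exact hC N ω k hN0 hω.1 hk h2 h3 Q hQ

/-- A bound on a norm of the density bounds the size of the support from below. -/
lemma IsStationary.le_ncard_support {ω : Env d} (hN : 0 < N) {Q : (Fin d → ℤ) → ℝ}
    (hQ : IsStationary ω N Q) {p q C : ℝ} (hpq : p.HolderConjugate q) (hC0 : 0 < C)
    (hC : cubeNorm N p (density N Q) < C) :
    (C ^ q)⁻¹ * ((cube d N).card : ℝ) ≤ (Function.support Q).ncard := by
  classical
  have hNN : (0 : ℝ) < (N : ℝ) ^ d := by positivity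
  have hp0 := hpq.pos
  have hq0 := hpq.symm.pos
  set B := (cube d N).filter (Q · ≠ 0) with hB
  have hsupp : Function.support Q = B := by
    ext x
    simp only [Function.mem_support, hB, Finset.coe_filter, Set.mem_ofPred_eq]
    exact ⟨fun h => ⟨by_contra fun h' => h (hQ.eq_zero_of_notMem x h'), h⟩, fun h => h.2⟩
  rw [hsupp, Set.ncard_coe_finset]
  have hD0 : ∀ x, 0 ≤ density N Q x := fun x => by
    rw [density_eq]; exact mul_nonneg (hQ.nonneg x) hNN.le
  have hA0 : 0 ≤ ∑ x ∈ cube d N, density N Q x ^ p :=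
    Finset.sum_nonneg fun x _ => Real.rpow_nonneg (hD0 x) _
  have hsum : ∑ x ∈ B, density N Q x = N ^ d := by
    rw [hB, Finset.sum_filter_of_ne]
    · simp only [density_eq, ← Finset.sum_mul, hQ.sum_eq_one, one_mul]
    · intro x _ h h0
      exact h (by rw [density_eq, h0, zero_mul])
  -- The density has total mass `N^d`, all of it on `B`; Hölder against the indicator of `B` forces
  -- `B` to be large.
  have hH := Real.inner_le_Lp_mul_Lq_of_nonneg B hpq (f := fun x => density N Q x)
    (g := fun _ => 1) (fun x _ => hD0 x) (fun _ _ => zero_le_one)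
  simp only [mul_one, hsum, Real.one_rpow, Finset.sum_const, nsmul_eq_mul] at hH
  have hle : (∑ x ∈ B, density N Q x ^ p) ^ (1 / p) ≤ C * ((N : ℝ) ^ d) ^ (1 / p) := by
    have h1 : (∑ x ∈ B, density N Q x ^ p) ^ (1 / p) ≤
        (∑ x ∈ cube d N, density N Q x ^ p) ^ (1 / p) := by
      refine Real.rpow_le_rpow (Finset.sum_nonneg fun x _ => Real.rpow_nonneg (hD0 x) _) ?_
        (by positivity)
      exact Finset.sum_le_sum_of_subset_of_nonneg (Finset.filter_subset _ _) fun x _ _ =>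
        Real.rpow_nonneg (hD0 x) _
    refine h1.trans ?_
    rw [cubeNorm, card_cube, Real.mul_rpow (by positivity)
      (Finset.sum_nonneg fun x _ => Real.rpow_nonneg (abs_nonneg _) _)] at hC
    simp only [abs_of_nonneg (hD0 _)] at hC
    rw [Real.div_rpow zero_le_one hNN.le, Real.one_rpow, one_div_mul_eq_div,
      div_lt_iff₀ (by positivity)] at hC
    exact hC.le
  have hsplit : ((N : ℝ) ^ d) = ((N : ℝ) ^ d) ^ (1 / p) * ((N : ℝ) ^ d) ^ (1 / q) := by
    rw [← Real.rpow_add hNN]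
    have : 1 / p + 1 / q = 1 := by simpa [one_div] using hpq.inv_add_inv_eq_one
    rw [this, Real.rpow_one]
  have hfin : ((N : ℝ) ^ d) ^ (1 / q) ≤ C * (B.card : ℝ) ^ (1 / q) := by
    have h2 : ((N : ℝ) ^ d) ^ (1 / p) * ((N : ℝ) ^ d) ^ (1 / q) ≤
        ((N : ℝ) ^ d) ^ (1 / p) * (C * (B.card : ℝ) ^ (1 / q)) := by
      rw [← hsplit]
      refine hH.trans ((mul_le_mul_of_nonneg_right hle
        (Real.rpow_nonneg (Nat.cast_nonneg _) _)).trans_eq ?_)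
      ring
    exact le_of_mul_le_mul_left h2 (Real.rpow_pos_of_pos hNN _)
  have hpow := Real.rpow_le_rpow (Real.rpow_nonneg hNN.le _) hfin hq0.le
  rw [Real.mul_rpow hC0.le (Real.rpow_nonneg (Nat.cast_nonneg _) _), ← Real.rpow_mul hNN.le,
    ← Real.rpow_mul (Nat.cast_nonneg _), one_div_mul_cancel hq0.ne', Real.rpow_one,
    Real.rpow_one] at hpow
  rw [card_cube, inv_mul_le_iff₀ (by positivity)]
  exact hpow

end RWRE

end

theorem mainTheorem5 (d : ℕ) (hd : 2 ≤ d)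
    (ν : MeasureTheory.Measure (RWRE.SiteLaw d)) [MeasureTheory.IsProbabilityMeasure ν]
    (hν : ∀ᵐ ω ∂(RWRE.envLaw ν), RWRE.Balanced ω ∧ RWRE.GenuinelyDDimensional ω) :
    (∀ p' : ℝ, 1 < p' → p' < (d : ℝ) / ((d : ℝ) - 1) →
      ∃ C : ℝ, ∀ᵐ ω ∂(RWRE.envLaw ν), ∀ᶠ N : ℕ in Filter.atTop,
        ∀ Q : (Fin d → ℤ) → ℝ, RWRE.IsStationary ω N Q →
          RWRE.cubeNorm N p' (RWRE.density N Q) < C) ∧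
    (∃ Φ : ℝ, 0 < Φ ∧ ∀ᵐ ω ∂(RWRE.envLaw ν), ∀ᶠ N : ℕ in Filter.atTop,
        ∀ Q : (Fin d → ℤ) → ℝ, RWRE.IsStationary ω N Q →
          Φ * ((RWRE.cube d N).card : ℝ) ≤ (Function.support Q).ncard) := by
  refine ⟨fun p' h1 hp => RWRE.exists_ae_eventually_cubeNorm_lt hd ν hν h1 hp, ?_⟩
  have hd' : (2 : ℝ) ≤ d := by exact_mod_cast hd
  obtain ⟨p', h1, hp⟩ := exists_between
    (show (1 : ℝ) < (d : ℝ) / ((d : ℝ) - 1) by rw [lt_div_iff₀ (by linarith)]; linarith)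
  obtain ⟨C, hC⟩ := RWRE.exists_ae_eventually_cubeNorm_lt hd ν hν h1 hp
  -- Any admissible `p'` serves for the support bound; the maximum with `1` makes the base visibly
  -- positive.
  refine ⟨((max C 1) ^ Real.conjExponent p')⁻¹, by positivity, ?_⟩
  filter_upwards [hC] with ω hω
  filter_upwards [hω, Filter.eventually_gt_atTop 0] with N hN hN0 Q hQ
  exact hQ.le_ncard_support hN0 (Real.HolderConjugate.conjExponent h1) (by positivity)
    ((hN Q hQ).trans_le (le_max_left _ _))
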